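/- All spaces carry Euclidean norms and products are normed by $\|(a,b)\|=\sqrt{\|a\|^2+\|b\|^2}$. **Setting.** Let $f:\mathbb{R}^n\times\mathbb{R}^m\to\mathbb{R}^m$ be continuously differentiable, let $Q:\mathbb{R}^n\times\mathbb{R}^m\rightrightarrows\mathbb{R}^m$ have closed graph, let $U_{ad}\subset\mathbb{R}^n$ be a convex polyhedron and $\Omega\supset U_{ad}$ an open set. Assume (A1') there is $\delta>0$ such that the perturbed solution mapping $\widetilde S(u,x):=\{y\mid u\in f(x,y)+Q(x,y)\}$ is single-valued (exactly one element, again denoted $\widetilde S(u,x)$) and locally Lipschitz on $\mathcal{B}_\delta(0)\times\Omega\subset\mathbb{R}^m\times\mathbb{R}^n$. Let $\varphi:\mathbb{R}^n\times\mathbb{R}^m\to\mathbb{R}$ be continuously differentiable on $\Omega\times\mathbb{R}^m$, and put $S(x):=\widetilde S(0,x)$ and $\tilde\vartheta(u,x):=\varphi(x,\widetilde S(u,x))$ for $(u,x)\in\mathcal{B}_\delta(0)\times\Omega$. **Definitions.** For a function $F$ on an open set, $\overline\nabla F(\bar x)$ is the set of all limits $\lim_k\nabla F(x_k)$ with $x_k\to\bar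 x$ and $F$ Fréchet differentiable at $x_k$; for a locally Lipschitz real-valued $h$, $\partial_c h(x):=(\mathrm{conv}\,\overline\nabla h(x))^T$. For a set-valued mapping $\Theta$, $\mathrm{cl}\,\Theta$ is the mapping whose graph is the closure of $\mathrm{gph}\,\Theta$, and $(\mathrm{cocl}\,\Theta)(x):=\mathrm{conv}\big((\mathrm{cl}\,\Theta)(x)\big)$. $T_A$ is the contingent (Bouligand) tangent cone and $N_A$ the limiting normal cone, i.e. $N_A(\bar x)=\operatorname{Lim\,sup}_{x\to\bar x,\,x\in A}(T_A(x))^\circ$. For $F:\mathbb{R}^p\rightrightarrows\mathbb{R}^q$, the adjoint SC derivative $\mathcal{S}^*F(x,y)$ is the set of all adjoint subspaces $L^*:=\{(-v^*,u^*)\in\mathbb{R}^q\times\mathbb{R}^p\mid(u^*,v^*)\in L^\perp\}$, where $L\subset\mathbb{R}^p\times\mathbb{R}^q$ is a $p$-dimensional subspace that is the limit, in the metric $\|P_L-P_{L'}\|$ of orthogonal projections, of tangent cones $T_{\mathrm{gph}F}(x_k,y_k)$ at points $(x_k,y_k)\to(x,y)$ of $\mathrm{gph}\,F$ at which this tangent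 cone is a $p$-dimensional subspace. For $x\in\Omega$ and $y=S(x)$ let $$\Psi(x):=\big\{-(\nabla_yf(x,y)^TZ^*+Y^*)^{-T}(Z^{*T}\nabla_xf(x,y)+X^{*T})\;\big|\;\mathrm{rge}(Z^*,X^*,Y^*)\in\mathcal{S}^*Q\big((x,y),-f(x,y)\big)\big\},$$ where $Z^*,Y^*\in\mathbb{R}^{m\times m}$, $X^*\in\mathbb{R}^{n\times m}$ (under the assumptions above the matrices to be inverted are nonsingular), and $$\Theta(x):=\{\nabla_x\varphi(x,S(x))+\nabla_y\varphi(x,S(x))A\mid A\in\Psi(x)\},$$ with $\Theta(x):=\emptyset$ for $x\notin\Omega$. **Claim.** For every $\hat x\in U_{ad}$, the pseudo-stationarity condition $$0\in(\mathrm{cocl}\,\Theta)(\hat x)^T+N_{U_{ad}}(\hat x)$$ holds if and only if $(0,\hat x)$ is Clarke stationary for the enhanced problem of minimizing $\tilde\vartheta(u,x)$ over $(u,x)\in\{0\}\times U_{ad}$, i.e. $$0\in\partial_c\tilde\vartheta(0,\hat x)+N_{\{0\}\times U_{ad}}(0,\hat x).$$ -/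

import Mathlib

open Set Filter Topology Metric
open scoped Pointwise

/-- The Euclidean space `ℝᵏ`. -/
abbrev Eu (k : ℕ) : Type := EuclideanSpace ℝ (Fin k)

/-- The product `X × Y` with the Euclidean norm `‖(x, y)‖ = √(‖x‖² + ‖y‖²)` and the corresponding
inner product. -/
abbrev EProd (X Y : Type) : Type := WithLp 2 (X × Y)

noncomputable section

/-! ### B-Jacobian, Clarke subdifferential, closure of set-valued mappings -/

/-- The B-Jacobian of `F` at `x`: all limits of Jacobians `∇F(xₖ)` at points of Fréchet
differentiability `xₖ → x`. If a function is of interest only on an open set `U`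
and `x ∈ U`, this depends only on its values on `U`, because `xₖ ∈ U` eventually. Matrices are
identified with continuous linear maps. -/
def bJacobian {V W : Type} [NormedAddCommGroup V] [NormedSpace ℝ V]
    [NormedAddCommGroup W] [NormedSpace ℝ W] (F : V → W) (x : V) : Set (V →L[ℝ] W) :=
  {A | ∃ xs : ℕ → V, Tendsto xs atTop (𝓝 x) ∧ (∀ k, DifferentiableAt ℝ F (xs k)) ∧
    Tendsto (fun k => fderiv ℝ F (xs k)) atTop (𝓝 A)}

/-- For a set `G` of row vectors (linear functionals), the set `Gᵀ` of the corresponding column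
vectors: `g ∈ Gᵀ` iff the functional `⟪g, ·⟫` belongs to `G`. -/
def colVectors {V : Type} [NormedAddCommGroup V] [InnerProductSpace ℝ V]
    (G : Set (V →L[ℝ] ℝ)) : Set V :=
  {g | innerSL ℝ g ∈ G}

/-- The Clarke subdifferential (the convex hull of the B-Jacobian, as column vectors). -/
def clarkeSubdiff {V : Type} [NormedAddCommGroup V] [InnerProductSpace ℝ V]
    (h : V → ℝ) (x : V) : Set V :=
  colVectors (convexHull ℝ (bJacobian h x))

/-- `cl Ψ`: the set-valued mapping whose graph is the closure of the graph of `Ψ`. -/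
def clMap {V W : Type} [TopologicalSpace V] [TopologicalSpace W] (Ψ : V → Set W) : V → Set W :=
  fun x => {y | (x, y) ∈ closure {p : V × W | p.2 ∈ Ψ p.1}}

/-- `cocl Ψ`: the pointwise convex hull of `cl Ψ`. -/
def coclMap {V W : Type} [TopologicalSpace V] [TopologicalSpace W] [AddCommGroup W] [Module ℝ W]
    (Ψ : V → Set W) : V → Set W :=
  fun x => convexHull ℝ (clMap Ψ x)

/-! ### Tangent and normal cones -/

/-- The contingent (Bouligand) tangent cone `T_A(a) = Lim sup_{t ↓ 0} (A - a) / t`. -/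
def contingentCone {V : Type} [NormedAddCommGroup V] [NormedSpace ℝ V] (A : Set V) (a : V) :
    Set V :=
  {v | ∃ (t : ℕ → ℝ) (w : ℕ → V), (∀ k, 0 < t k) ∧ Tendsto t atTop (𝓝 0) ∧
    Tendsto w atTop (𝓝 v) ∧ ∀ k, a + t k • w k ∈ A}

/-- The regular (Fréchet) normal cone: the negative polar of the contingent cone. -/
def regularNormalCone {V : Type} [NormedAddCommGroup V] [InnerProductSpace ℝ V]
    (A : Set V) (a : V) : Set V :=
  {v | ∀ w ∈ contingentCone A a, inner ℝ v w ≤ 0}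

/-- The limiting (Mordukhovich) normal cone. -/
def limitingNormalCone {V : Type} [NormedAddCommGroup V] [InnerProductSpace ℝ V]
    (A : Set V) (a : V) : Set V :=
  {v | ∃ as vs : ℕ → V, (∀ k, as k ∈ A) ∧ Tendsto as atTop (𝓝 a) ∧
    (∀ k, vs k ∈ regularNormalCone A (as k)) ∧ Tendsto vs atTop (𝓝 v)}

/-- A convex polyhedron: the solution set of finitely many affine inequalities. -/
def IsConvexPolyhedron {V : Type} [NormedAddCommGroup V] [InnerProductSpace ℝ V]
    (U : Set V) : Prop :=
  ∃ (l : ℕ) (a : Fin l → V) (b : Fin l → ℝ), U = {x | ∀ i, inner ℝ (a i) x ≤ b i}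

/-! ### Subspace containing derivatives -/

/-- The graph of a set-valued mapping. -/
def graphOf {X Y : Type} (F : X → Set Y) : Set (EProd X Y) :=
  {p | p.snd ∈ F p.fst}

/-- The SC derivative `𝒮F(x, y)` at `p = (x, y)`, for `F : X ⇉ Y` with `X`, `Y` Euclidean:
all subspaces `L` of dimension `dim X` that are limits (for the distance
`‖P_L - P_L'‖` of the orthogonal projections) of the tangent cones `T_{gph F}(pₖ)` at points
`pₖ → p` of `gph F` where this tangent cone is a subspace of dimension `dim X`. -/
def scDeriv {X Y : Type} [NormedAddCommGroup X] [InnerProductSpace ℝ X] [FiniteDimensional ℝ X]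
    [NormedAddCommGroup Y] [InnerProductSpace ℝ Y] [FiniteDimensional ℝ Y]
    (F : X → Set Y) (p : EProd X Y) : Set (Submodule ℝ (EProd X Y)) :=
  {L | Module.finrank ℝ L = Module.finrank ℝ X ∧
    ∃ (ps : ℕ → EProd X Y) (Ls : ℕ → Submodule ℝ (EProd X Y)),
      Tendsto ps atTop (𝓝 p) ∧
      (∀ k, ps k ∈ graphOf F ∧ (Ls k : Set (EProd X Y)) = contingentCone (graphOf F) (ps k) ∧
        Module.finrank ℝ (Ls k) = Module.finrank ℝ X) ∧
      Tendsto (fun k => ‖L.starProjection - (Ls k).starProjection‖) atTop (𝓝 0)}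

/-- The adjoint subspace `L* = {(-v*, u*) | (u*, v*) ∈ L^⊥}`. -/
def adjointSubspace {X Y : Type} [NormedAddCommGroup X] [InnerProductSpace ℝ X]
    [NormedAddCommGroup Y] [InnerProductSpace ℝ Y]
    (L : Submodule ℝ (EProd X Y)) : Set (EProd Y X) :=
  {q | ∃ (u : X) (v : Y), WithLp.toLp 2 (u, v) ∈ Lᗮ ∧ q = WithLp.toLp 2 (-v, u)}

/-- The adjoint SC derivative `𝒮*F(x, y) = {L* | L ∈ 𝒮F(x, y)}`. -/
def adjointSCDeriv {X Y : Type} [NormedAddCommGroup X] [InnerProductSpace ℝ X]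
    [FiniteDimensional ℝ X] [NormedAddCommGroup Y] [InnerProductSpace ℝ Y]
    [FiniteDimensional ℝ Y] (F : X → Set Y) (p : EProd X Y) : Set (Set (EProd Y X)) :=
  adjointSubspace '' scDeriv F p

/-! ### The generalized equation `0 ∈ f(x, y) + Q(x, y)` and its perturbation -/

/-- The perturbed solution mapping `S̃(u, x) = {y | u ∈ f(x, y) + Q(x, y)}`. -/
def perturbedSolutions {n m : ℕ} (f : Eu n → Eu m → Eu m) (Q : Eu n → Eu m → Set (Eu m))
    (u : Eu m) (x : Eu n) : Set (Eu m) :=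
  {y | ∃ z ∈ Q x y, u = f x y + z}

/-- `Q` as a set-valued mapping on the Euclidean space `ℝⁿ × ℝᵐ`. -/
def uncurryMap {n m : ℕ} (Q : Eu n → Eu m → Set (Eu m)) : EProd (Eu n) (Eu m) → Set (Eu m) :=
  fun p => Q p.fst p.snd

/-- The range of the stacked matrix `(Z, X, Y)`, i.e. `{(Z p, (X p, Y p)) | p ∈ ℝᵐ}`. -/
def rangeOfBasis {n m : ℕ} (Z : Eu m →L[ℝ] Eu m) (X : Eu m →L[ℝ] Eu n) (Y : Eu m →L[ℝ] Eu m) :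
    Set (EProd (Eu m) (EProd (Eu n) (Eu m))) :=
  Set.range fun p => WithLp.toLp 2 (Z p, WithLp.toLp 2 (X p, Y p))

/-- The mapping `Ψ`: for `x ∈ Ω` and `y = σ(x)`, the set of all
`-(∇_y f(x,y)ᵀ Z + Y)^{-T} (Zᵀ ∇_x f(x,y) + Xᵀ)` with `rge (Z, X, Y) ∈ 𝒮*Q((x, y), -f(x, y))`;
empty for `x ∉ Ω`. -/
def implicitPsi {n m : ℕ} (f : Eu n → Eu m → Eu m) (Q : Eu n → Eu m → Set (Eu m))
    (Ω : Set (Eu n)) (σ : Eu n → Eu m) (x : Eu n) : Set (Eu n →L[ℝ] Eu m) :=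
  {A | x ∈ Ω ∧ ∃ (Z : Eu m →L[ℝ] Eu m) (X : Eu m →L[ℝ] Eu n) (Y : Eu m →L[ℝ] Eu m),
    rangeOfBasis Z X Y ∈ adjointSCDeriv (uncurryMap Q)
      (WithLp.toLp 2 (WithLp.toLp 2 (x, σ x), -f x (σ x))) ∧
    A = -((ContinuousLinearMap.adjoint
            ((ContinuousLinearMap.adjoint (fderiv ℝ (fun y => f x y) (σ x))) ∘L Z + Y).inverse) ∘L
          ((ContinuousLinearMap.adjoint Z) ∘L (fderiv ℝ (fun x' => f x' (σ x)) x) +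
            ContinuousLinearMap.adjoint X))}

/-- The mapping `Θ`: for `x ∈ Ω`, the set of all row vectors `g_xᵀ + g_yᵀ A` with
`(g_xᵀ, g_yᵀ) ∈ Φ(x, σ(x))` and `A ∈ Ψ(x)`; empty for `x ∉ Ω`. -/
def implicitTheta {n m : ℕ} (f : Eu n → Eu m → Eu m) (Q : Eu n → Eu m → Set (Eu m))
    (Φ : Eu n → Eu m → Set ((Eu n →L[ℝ] ℝ) × (Eu m →L[ℝ] ℝ)))
    (Ω : Set (Eu n)) (σ : Eu n → Eu m) (x : Eu n) : Set (Eu n →L[ℝ] ℝ) :=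
  {ξ | x ∈ Ω ∧ ∃ g ∈ Φ x (σ x), ∃ A ∈ implicitPsi f Q Ω σ x, ξ = g.1 + g.2 ∘L A}

/-- For a differentiable `φ`, the single-valued mapping `Φ = {∇φ}`, with `∇φ(x, y)` split into
its blocks `(∇_x φ(x, y), ∇_y φ(x, y))`. -/
def gradientMap {n m : ℕ} (φ : Eu n → Eu m → ℝ) :
    Eu n → Eu m → Set ((Eu n →L[ℝ] ℝ) × (Eu m →L[ℝ] ℝ)) :=
  fun x y => {(fderiv ℝ (fun x' => φ x' y) x, fderiv ℝ (fun y' => φ x y') y)}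

/-- The pseudo-stationarity condition `0 ∈ (cocl Θ)(x)ᵀ + N_U(x)`. -/
def IsPseudoStationary {n : ℕ} (Θ : Eu n → Set (Eu n →L[ℝ] ℝ)) (U : Set (Eu n)) (x : Eu n) :
    Prop :=
  (0 : Eu n) ∈ colVectors (coclMap Θ x) + limitingNormalCone U x

/-- Clarke stationarity `0 ∈ ∂_c h(z) + N_C(z)` for the problem of minimizing `h` over `C`. -/
def IsClarkeStationary {V : Type} [NormedAddCommGroup V] [InnerProductSpace ℝ V]
    (h : V → ℝ) (C : Set V) (z : V) : Prop :=
  (0 : V) ∈ clarkeSubdiff h z + limitingNormalCone C z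

end

/-! The substitution `u = f(x, y) + z` turns the graph of `Q`, over the parameters in `𝓑_δ(0) × Ω`,
into the set of points `(x, S̃(u, x), u - f(x, S̃(u, x)))`. The parameter `(u, x)` of a point is
recovered by the `C¹` map `(x, y, z) ↦ (f(x, y) + z, x)`. Up to a linear isomorphism, tangent cones
of `gph Q` are therefore graphical derivatives of the Lipschitz map `S̃`, and such a cone is an `(n
+ m)`-dimensional subspace exactly when `S̃` is Fréchet differentiable at the parameter. In the
limit, the SC derivative of `Q` at `((x, y), -f(x, y))` corresponds to the B-Jacobian of `S̃` at
`(0, x)` (`mem_scDeriv_iff`).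

Linear algebra with adjoints shows that the formula defining `Ψ` returns the `x`-block of the
corresponding Jacobian, whatever basis `(Z, X, Y)` is used (`eq_of_rangeOfBasis_eq`,
`implicitPsi_eq`). Thus `Θ(x)` is the image of a compact B-Jacobian under a map depending
continuously on `x`, which makes its graph closed over `Ω` (`clMap_implicitTheta`).

It remains to identify `conv Θ(x)` with the `x`-blocks of the Clarke subdifferential of `ϑ̃` at `(0,
x)` (`convexHull_implicitTheta`). The obstacle is that `ϑ̃` may be differentiable where `S̃` is not.
By Rademacher such points form a null set, and null sets do not affect the convex hull of limiting
gradients (`bJacobian_subset_convexHull`). Finally, the normal cone to `{0} × U` is `ℝᵐ × N_U`, so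
the `u`-block imposes no condition (`zero_mem_colVectors_add_iff`). -/

/-! ### Compactness of convex hulls. -/

section ConvexHull

/-- In a finite-dimensional space, the convex hull of a compact set is compact. -/
theorem isCompact_convexHull_of_isCompact {E : Type*} [NormedAddCommGroup E] [NormedSpace ℝ E]
    [FiniteDimensional ℝ E] {K : Set E} (hK : IsCompact K) : IsCompact (convexHull ℝ K) := by
  -- By Carathéodory, `dim E + 1` points suffice, so the hull is a continuous image of the compact
  -- set of weights and points.
  set N := Module.finrank ℝ E + 1
  have hcomp : IsCompact (stdSimplex ℝ (Fin N) ×ˢ (univ.pi fun _ : Fin N => K)) :=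
    (isCompact_stdSimplex ℝ (Fin N)).prod (isCompact_univ_pi fun _ => hK)
  have hcont : Continuous fun p : (Fin N → ℝ) × (Fin N → E) => ∑ i, p.1 i • p.2 i := by fun_prop
  convert hcomp.image hcont using 1
  apply Subset.antisymm
  · intro x hx
    obtain ⟨ι, _, z, w, hz, hind, hw, hsum, rfl⟩ := eq_pos_convex_span_of_mem_convexHull hx
    have hcard : Fintype.card ι ≤ Fintype.card (Fin N) := by
      rw [Fintype.card_fin]
      exact hind.card_le_finrank_succ.trans (Nat.succ_le_succ (Submodule.finrank_le _))
    obtain ⟨e⟩ := Function.Embedding.nonempty_of_card_le hcard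
    have hne : Nonempty ι := by
      by_contra h
      rw [not_nonempty_iff] at h
      simp at hsum
    obtain ⟨i₀⟩ := hne
    -- A shorter combination is padded with weight `0` at the arbitrary point `z i₀`, which keeps
    -- every slot inside `K`.
    refine ⟨(Function.extend e w 0, Function.extend e z fun _ => z i₀), ⟨⟨fun j => ?_, ?_⟩, ?_⟩, ?_⟩
    · by_cases hj : ∃ i, e i = j
      · obtain ⟨i, rfl⟩ := hj
        simpa [e.injective.extend_apply] using (hw i).le
      · simp [Function.extend_apply' _ _ _ hj]
    · rw [← hsum]
      refine (Fintype.sum_of_injective e e.injective _ _ (fun j hj => ?_) fun i => ?_).symm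
      · simp [Function.extend_apply' _ _ _ hj]
      · simp [e.injective.extend_apply]
    · intro j _
      by_cases hj : ∃ i, e i = j
      · obtain ⟨i, rfl⟩ := hj
        simpa [e.injective.extend_apply] using hz (mem_range_self i)
      · simpa [Function.extend_apply' _ _ _ hj] using hz (mem_range_self i₀)
    · refine (Fintype.sum_of_injective e e.injective _ _ (fun j hj => ?_) fun i => ?_).symm
      · simp [Function.extend_apply' _ _ _ hj]
      · simp [e.injective.extend_apply]
  · rintro _ ⟨⟨w, z⟩, ⟨⟨hw, hsum⟩, hz⟩, rfl⟩
    exact (convex_convexHull ℝ K).sum_mem (fun i _ => hw i) hsum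
      fun i _ => subset_convexHull ℝ K (hz i (mem_univ i))

end ConvexHull

/-! ### Directional derivative bounds that hold off a null set. -/

section NullSets

open MeasureTheory

/-- If the derivative of a Lipschitz function in direction `v` is at most `a` almost everywhere on
an open set, then it is at most `a` at all points of differentiability. -/
theorem LipschitzWith.fderiv_apply_le_of_ae_le {E : Type*} [NormedAddCommGroup E] [NormedSpace ℝ E]
    [FiniteDimensional ℝ E] [MeasurableSpace E] [BorelSpace E] {μ : Measure E} [μ.IsAddHaarMeasure]
    {h : E → ℝ} {C : NNReal} (hh : LipschitzWith C h) {s : Set E} (hs : IsOpen s) {v : E} {a : ℝ}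
    (hae : ∀ᵐ y ∂μ, y ∈ s → fderiv ℝ h y v ≤ a) {y₀ : E} (hy₀ : y₀ ∈ s)
    (hd : DifferentiableAt ℝ h y₀) : fderiv ℝ h y₀ v ≤ a := by
  have hP : ∀ᵐ y ∂μ, DifferentiableAt ℝ h y ∧ (y ∈ s → fderiv ℝ h y v ≤ a) :=
    hh.ae_differentiableAt.and hae
  -- A measurable null superset of the bad points is needed to apply Fubini.
  set N : Set E := toMeasurable μ {y | ¬(DifferentiableAt ℝ h y ∧ (y ∈ s → fderiv ℝ h y v ≤ a))}
  have hN : μ N = 0 := by rw [measure_toMeasurable]; exact hP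
  have hNm : MeasurableSet N := measurableSet_toMeasurable _ _
  have hNP : ∀ y, y ∉ N → DifferentiableAt ℝ h y ∧ (y ∈ s → fderiv ℝ h y v ≤ a) := by
    intro y hy
    by_contra hcon
    exact hy (subset_toMeasurable μ _ hcon)
  -- Fubini: each translate of `N` by `t • v` is null, so almost every line in direction `v` meets
  -- `N` in a null set.
  have hlines : ∀ᵐ y ∂μ, ∀ᵐ t : ℝ, y + t • v ∉ N := by
    have hmeas : MeasurableSet {p : E × ℝ | p.1 + p.2 • v ∉ N} := by
      have : Measurable fun p : E × ℝ => p.1 + p.2 • v :=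
        (by fun_prop : Continuous fun p : E × ℝ => p.1 + p.2 • v).measurable
      exact this hNm.compl
    rw [Measure.ae_ae_comm hmeas]
    refine Eventually.of_forall fun t => ?_
    have := measure_preimage_add_right μ (t • v) N
    rw [hN] at this
    rw [ae_iff]
    simp only [not_not]
    exact this
  -- On such a line `h` is absolutely continuous, and integrating the almost everywhere bound on its
  -- derivative bounds the increment.
  have hincr : ∀ y, (∀ᵐ t : ℝ, y + t • v ∉ N) → ∀ T : ℝ, 0 ≤ T →
      (∀ t ∈ Icc 0 T, y + t • v ∈ s) → h (y + T • v) - h y ≤ a * T := by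
    intro y hy T hT hseg
    set g : ℝ → ℝ := fun t => h (y + t • v)
    have hline : ∀ t, HasDerivAt (fun t : ℝ => y + t • v) v t := fun t => by
      simpa using ((hasDerivAt_id t).smul_const v).const_add y
    have hg : LipschitzWith (C * ‖v‖₊) g := by
      refine hh.comp (LipschitzWith.of_dist_le_mul fun t t' => ?_)
      rw [dist_add_left, dist_eq_norm, ← sub_smul, norm_smul, mul_comm, dist_eq_norm, coe_nnnorm]
    have hac : AbsolutelyContinuousOnInterval g 0 T :=
      (hg.lipschitzOnWith (s := uIcc 0 T)).absolutelyContinuousOnInterval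
    have hle : ∫ t in (0 : ℝ)..T, deriv g t ≤ ∫ t in (0 : ℝ)..T, a := by
      refine intervalIntegral.integral_mono_ae_restrict hT hac.intervalIntegrable_deriv
        intervalIntegrable_const ?_
      refine (ae_restrict_iff' measurableSet_Icc).2 ?_
      filter_upwards [hy] with t ht htI
      obtain ⟨hd, hle⟩ := hNP _ ht
      have : HasDerivAt g (fderiv ℝ h (y + t • v) v) t := hd.hasFDerivAt.comp_hasDerivAt t (hline t)
      rw [this.deriv]
      exact hle (hseg t htI)
    rw [hac.integral_deriv_eq_sub] at hle
    simpa [g, mul_comm] using hle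
  obtain ⟨r, hr, hball⟩ := Metric.isOpen_iff.1 hs y₀ hy₀
  -- The line through `y₀` itself may be bad. Good base points are dense and the increment
  -- inequality is closed in `y`; the halves of `r` keep segments from nearby base points inside the
  -- ball.
  have hsmall : ∀ T : ℝ, 0 ≤ T → T * ‖v‖ < r / 2 → h (y₀ + T • v) - h y₀ ≤ a * T := by
    intro T hT hTr
    have hdense : Dense {y | ∀ᵐ t : ℝ, y + t • v ∉ N} := Measure.dense_of_ae hlines
    have hmem : y₀ ∈ closure (ball y₀ (r / 2) ∩ {y | ∀ᵐ t : ℝ, y + t • v ∉ N}) :=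
      hdense.open_subset_closure_inter isOpen_ball (mem_ball_self (by positivity))
    have hclosed : IsClosed {y | h (y + T • v) - h y ≤ a * T} := by
      have := hh.continuous
      exact isClosed_le (by fun_prop) (by fun_prop)
    refine closure_minimal ?_ hclosed hmem
    rintro y ⟨hy, hyN⟩
    refine hincr y hyN T hT fun t ht => hball ?_
    rw [mem_ball, dist_eq_norm] at hy ⊢
    have h1 : ‖t • v‖ ≤ T * ‖v‖ := by
      rw [norm_smul, Real.norm_of_nonneg ht.1]
      exact mul_le_mul_of_nonneg_right ht.2 (norm_nonneg v)
    have h2 : y + t • v - y₀ = (y - y₀) + t • v := by abel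
    rw [h2]
    exact (norm_add_le _ _).trans_lt (by linarith)
  have hlim := (hd.hasFDerivAt.hasLineDerivAt v).tendsto_slope_zero_right
  refine le_of_tendsto hlim ?_
  have hev : ∀ᶠ T : ℝ in 𝓝[>] 0, T * ‖v‖ < r / 2 := by
    have : Tendsto (fun T : ℝ => T * ‖v‖) (𝓝[>] 0) (𝓝 0) := by
      have h0 := (continuous_mul_const ‖v‖).tendsto 0
      rw [zero_mul] at h0
      exact h0.mono_left nhdsWithin_le_nhds
    exact this.eventually (gt_mem_nhds (by positivity))
  filter_upwards [hev, self_mem_nhdsWithin] with T hT hT0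
  have hT0 : 0 < T := hT0
  rw [smul_eq_mul, inv_mul_le_iff₀ hT0, mul_comm T a]
  exact hsmall T hT0.le hT

end NullSets

/-! ### Closedness and compactness of the B-Jacobian. -/

section BJacobian

variable {V W : Type} [NormedAddCommGroup V] [NormedSpace ℝ V] [NormedAddCommGroup W]
  [NormedSpace ℝ W]

/-- With the limits written as a closure, closedness of the graph of the B-Jacobian needs no
diagonal sequence. -/
theorem bJacobian_eq_closure (F : V → W) (x : V) :
    bJacobian F x = {A | (x, A) ∈ closure
      {p : V × (V →L[ℝ] W) | DifferentiableAt ℝ F p.1 ∧ p.2 = fderiv ℝ F p.1}} := by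
  ext A
  rw [mem_ofPred_eq, mem_closure_iff_seq_limit]
  constructor
  · rintro ⟨xs, hxs, hd, hA⟩
    exact ⟨fun k => (xs k, fderiv ℝ F (xs k)), fun k => ⟨hd k, rfl⟩, hxs.prodMk_nhds hA⟩
  · rintro ⟨p, hp, hlim⟩
    rw [nhds_prod_eq, tendsto_prod_iff'] at hlim
    exact ⟨fun k => (p k).1, hlim.1, fun k => (hp k).1, by simpa only [← (hp _).2] using hlim.2⟩

theorem fderiv_mem_bJacobian {F : V → W} {x : V} (h : DifferentiableAt ℝ F x) :
    fderiv ℝ F x ∈ bJacobian F x :=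
  ⟨fun _ => x, tendsto_const_nhds, fun _ => h, tendsto_const_nhds⟩

theorem mem_bJacobian_of_tendsto {F : V → W} {x : V} {xs : ℕ → V} {As : ℕ → V →L[ℝ] W}
    {A : V →L[ℝ] W} (hxs : Tendsto xs atTop (𝓝 x)) (hAs : ∀ k, As k ∈ bJacobian F (xs k))
    (hA : Tendsto As atTop (𝓝 A)) : A ∈ bJacobian F x := by
  rw [bJacobian_eq_closure]
  refine isClosed_closure.mem_of_tendsto (hxs.prodMk_nhds hA) (Eventually.of_forall fun k => ?_)
  have := hAs k
  rwa [bJacobian_eq_closure] at this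

theorem norm_le_of_mem_bJacobian {F : V → W} {x : V} {r : ℝ} {C : NNReal}
    (hF : LipschitzOnWith C F (ball x r)) {y : V} (hy : y ∈ ball x r) {A : V →L[ℝ] W}
    (hA : A ∈ bJacobian F y) : ‖A‖ ≤ C := by
  obtain ⟨ys, hys, -, hlim⟩ := hA
  refine le_of_tendsto hlim.norm ?_
  filter_upwards [hys (isOpen_ball.mem_nhds hy)] with k hk
  exact norm_fderiv_le_of_lipschitzOn ℝ (isOpen_ball.mem_nhds hk) hF

/-- The Lipschitz constant bounds all limiting Jacobians near `x`, so Bolzano–Weierstrass gives a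
limit and closedness of the graph places it in the B-Jacobian. -/
theorem exists_subseq_tendsto_bJacobian [FiniteDimensional ℝ V] [FiniteDimensional ℝ W]
    {F : V → W} {x : V} {r : ℝ} (hr : 0 < r) {C : NNReal} (hF : LipschitzOnWith C F (ball x r))
    {xs : ℕ → V} (hxs : Tendsto xs atTop (𝓝 x)) {As : ℕ → V →L[ℝ] W}
    (hAs : ∀ k, As k ∈ bJacobian F (xs k)) :
    ∃ A ∈ bJacobian F x, ∃ κ : ℕ → ℕ, StrictMono κ ∧ Tendsto (As ∘ κ) atTop (𝓝 A) := by
  have hev : ∀ᶠ k in atTop, As k ∈ closedBall (0 : V →L[ℝ] W) C := by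
    filter_upwards [hxs (ball_mem_nhds x hr)] with k hk
    simpa using norm_le_of_mem_bJacobian hF hk (hAs k)
  have : FiniteDimensional ℝ (V →L[ℝ] W) := inferInstance
  have : ProperSpace (V →L[ℝ] W) := FiniteDimensional.proper ℝ _
  obtain ⟨A, -, κ, hκ, hlim⟩ :=
    tendsto_subseq_of_frequently_bounded isBounded_closedBall hev.frequently
  exact ⟨A, mem_bJacobian_of_tendsto (hxs.comp hκ.tendsto_atTop) (fun k => hAs (κ k)) hlim,
    κ, hκ, hlim⟩

theorem isCompact_bJacobian [FiniteDimensional ℝ V] [FiniteDimensional ℝ W]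
    {F : V → W} {x : V} {r : ℝ} (hr : 0 < r) {C : NNReal} (hF : LipschitzOnWith C F (ball x r)) :
    IsCompact (bJacobian F x) := by
  rw [isCompact_iff_isSeqCompact]
  intro As hAs
  exact exists_subseq_tendsto_bJacobian hr hF tendsto_const_nhds hAs

end BJacobian

/-! ### Insensitivity of the Clarke subdifferential to null sets. -/

section Insensitivity

open MeasureTheory

variable {V : Type} [NormedAddCommGroup V] [InnerProductSpace ℝ V] [FiniteDimensional ℝ V]

/-- Reflexivity: a functional separating gradients becomes a direction `v`, so separation is a
statement about directional derivatives. -/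
theorem exists_forall_apply_eq_apply (l : StrongDual ℝ (V →L[ℝ] ℝ)) :
    ∃ v : V, ∀ A : V →L[ℝ] ℝ, l A = A v := by
  have : CompleteSpace V := FiniteDimensional.complete ℝ V
  let e := InnerProductSpace.toDual ℝ V
  let l' : StrongDual ℝ V := LinearMap.toContinuousLinearMap
    { toFun := fun w => l (e w)
      map_add' := fun w w' => by simp
      map_smul' := fun c w => by simp }
  refine ⟨e.symm l', fun A => ?_⟩
  have h1 : l A = l' (e.symm A) := by simp [l']
  have h2 : l' (e.symm A) = inner ℝ (e.symm l') (e.symm A) := by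
    rw [← InnerProductSpace.toDual_apply_apply, LinearIsometryEquiv.apply_symm_apply]
  have h3 : A (e.symm l') = inner ℝ (e.symm A) (e.symm l') := by
    rw [← InnerProductSpace.toDual_apply_apply, LinearIsometryEquiv.apply_symm_apply]
  rw [h1, h2, h3, real_inner_comm]

/-- The limits of gradients of a Lipschitz function lie in the convex hull of any compact set that
catches the cluster points of gradients along sequences avoiding a fixed null set. -/
theorem bJacobian_subset_convexHull [MeasurableSpace V] [BorelSpace V] {μ : Measure V}
    [μ.IsAddHaarMeasure] {h : V → ℝ} {x : V} {r : ℝ} (hr : 0 < r) {C : NNReal}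
    (hh : LipschitzOnWith C h (ball x r)) {D : Set V} (hD : ∀ᵐ y ∂μ, y ∈ ball x r → y ∈ D)
    {K : Set (V →L[ℝ] ℝ)} (hK : IsCompact K)
    (hlim : ∀ xs : ℕ → V, Tendsto xs atTop (𝓝 x) → (∀ k, xs k ∈ D) →
      ∃ A ∈ K, ∃ κ : ℕ → ℕ, StrictMono κ ∧
        Tendsto (fun k => fderiv ℝ h (xs (κ k))) atTop (𝓝 A)) :
    bJacobian h x ⊆ convexHull ℝ K := by
  rintro G ⟨xs, hxs, hd, hG⟩
  by_contra hcon
  obtain ⟨l, u, hlK, hlG⟩ := geometric_hahn_banach_closed_point (convex_convexHull ℝ K)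
    (isCompact_convexHull_of_isCompact hK).isClosed hcon
  obtain ⟨v, hv⟩ := exists_forall_apply_eq_apply l
  rw [hv] at hlG
  -- Otherwise gradients along points of `D` tending to `x` would have a cluster point in `K`
  -- violating the separation.
  have hnear : ∃ ε > 0, ∀ y ∈ D ∩ ball x ε, fderiv ℝ h y v ≤ u := by
    by_contra! hno
    have hno' : ∀ k : ℕ, ∃ y ∈ D ∩ ball x (1 / ((k : ℝ) + 1)), u < fderiv ℝ h y v := fun k =>
      hno _ (by positivity)
    choose ys hys hu using hno'
    have hyx : Tendsto ys atTop (𝓝 x) := by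
      rw [tendsto_iff_dist_tendsto_zero]
      exact squeeze_zero (fun _ => dist_nonneg) (fun k => (mem_ball.1 (hys k).2).le)
        tendsto_one_div_add_atTop_nhds_zero_nat
    obtain ⟨A, hA, κ, -, hκ⟩ := hlim ys hyx fun k => (hys k).1
    have h1 : u ≤ A v := ge_of_tendsto ((ContinuousLinearMap.apply ℝ ℝ v).continuous.tendsto A
      |>.comp hκ) (Eventually.of_forall fun k => (hu (κ k)).le)
    have h2 := hlK A (subset_convexHull ℝ K hA)
    rw [hv] at h2
    exact absurd h1 (not_le.2 h2)
  obtain ⟨ε, hε, hball⟩ := hnear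
  -- The directional bound is proved for globally Lipschitz functions; the extension has the same
  -- derivatives inside the ball.
  obtain ⟨g, hg, hgh⟩ := hh.extend_real
  have heq : ∀ y ∈ ball x r, h =ᶠ[𝓝 y] g := fun y hy =>
    hgh.eventuallyEq_of_mem (isOpen_ball.mem_nhds hy)
  have hae : ∀ᵐ y ∂μ, y ∈ ball x r ∩ ball x ε → fderiv ℝ g y v ≤ u := by
    filter_upwards [hD] with y hy hy'
    rw [← (heq y hy'.1).fderiv_eq]
    exact hball y ⟨hy hy'.1, hy'.2⟩
  have hle : G v ≤ u := by
    refine le_of_tendsto ((ContinuousLinearMap.apply ℝ ℝ v).continuous.tendsto G |>.comp hG) ?_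
    filter_upwards [hxs (inter_mem (ball_mem_nhds x hr) (ball_mem_nhds x hε))] with k hk
    have hk' : xs k ∈ ball x r ∩ ball x ε := hk
    have hgd : DifferentiableAt ℝ g (xs k) := (heq _ hk'.1).differentiableAt_iff.1 (hd k)
    have := hg.fderiv_apply_le_of_ae_le (isOpen_ball.inter isOpen_ball) hae hk' hgd
    rw [← (heq _ hk'.1).fderiv_eq] at this
    exact this
  exact absurd hle (not_le.2 hlG)

end Insensitivity

/-! ### Chain rule for Clarke subdifferentials. -/

section Composition

theorem continuous_clm_prod {V W Z : Type*} [NormedAddCommGroup V] [NormedSpace ℝ V]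
    [NormedAddCommGroup W] [NormedSpace ℝ W] [NormedAddCommGroup Z] [NormedSpace ℝ Z] :
    Continuous fun q : (V →L[ℝ] W) × (V →L[ℝ] Z) => q.1.prod q.2 :=
  (ContinuousLinearMap.prodₗᵢ ℝ : _ ≃ₗᵢ[ℝ] V →L[ℝ] W × Z).continuous


open MeasureTheory

variable {V W : Type} [NormedAddCommGroup V] [InnerProductSpace ℝ V] [FiniteDimensional ℝ V]
  [NormedAddCommGroup W] [NormedSpace ℝ W] [FiniteDimensional ℝ W]
  {U : Type} [NormedAddCommGroup U] [NormedSpace ℝ U]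

omit [FiniteDimensional ℝ V] [FiniteDimensional ℝ W] in
theorem continuous_comp_prod (T : V →L[ℝ] U) : Continuous fun q : ((U × W) →L[ℝ] ℝ) × (V →L[ℝ] W) =>
    q.1 ∘L T.prod q.2 := by
  exact continuous_fst.clm_comp
    (continuous_clm_prod.comp (continuous_const.prodMk continuous_snd))

/-- Chain rule for the Clarke subdifferential of `p ↦ g (T p, F p)`, with `F` Lipschitz and `g`
continuously differentiable. -/
theorem convexHull_bJacobian_comp_prod {F : V → W} {z : V} {r : ℝ} (hr : 0 < r) {C : NNReal}
    (hF : LipschitzOnWith C F (ball z r)) {T : V →L[ℝ] U} {g : U × W → ℝ}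
    (hg : ContDiffAt ℝ 1 g (T z, F z)) :
    convexHull ℝ (bJacobian (fun p => g (T p, F p)) z) = convexHull ℝ
      ((fun J : V →L[ℝ] W => fderiv ℝ g (T z, F z) ∘L T.prod J) ''
        bJacobian F z) := by
  have hFc : Tendsto (fun p => (T p, F p)) (𝓝 z) (𝓝 (T z, F z)) :=
    (T.continuous.tendsto z).prodMk_nhds (hF.continuousOn.continuousAt (ball_mem_nhds z hr))
  obtain ⟨K, t, ht, hK⟩ := hg.exists_lipschitzOnWith
  have hgd : ∀ᶠ q in 𝓝 (T z, F z), DifferentiableAt ℝ g q :=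
    (hg.eventually (by simp)).mono fun q hq => hq.differentiableAt (by simp)
  obtain ⟨r', hr', hr't⟩ := Metric.eventually_nhds_iff_ball.1
    ((hFc.eventually (ht : ∀ᶠ q in 𝓝 (T z, F z), q ∈ t)).and
      ((hFc.eventually hgd).and (ball_mem_nhds z hr)))
  have hsub : ball z r' ⊆ ball z r := fun p hp => (hr't p hp).2.2
  have hlip : LipschitzOnWith (K * max ‖T‖₊ C) (fun p => g (T p, F p)) (ball z r') :=
    hK.comp (((T.lipschitz.lipschitzOnWith).prodMk (hF.mono hsub)))
      fun p hp => (hr't p hp).1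
  have hchain : ∀ y ∈ ball z r', DifferentiableAt ℝ F y → HasFDerivAt (fun p => g (T p, F p))
      (fderiv ℝ g (T y, F y) ∘L T.prod (fderiv ℝ F y)) y := fun y hy hd =>
    (hr't y hy).2.1.hasFDerivAt.comp y (T.hasFDerivAt.prodMk hd.hasFDerivAt)
  have hcont : ∀ (ys : ℕ → V) (Js : ℕ → V →L[ℝ] W) (J : V →L[ℝ] W), Tendsto ys atTop (𝓝 z) →
      Tendsto Js atTop (𝓝 J) → Tendsto (fun k => fderiv ℝ g (T (ys k), F (ys k)) ∘L
        T.prod (Js k)) atTop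
        (𝓝 (fderiv ℝ g (T z, F z) ∘L T.prod J)) := by
    intro ys Js J hys hJs
    have h1 : Tendsto (fun k => fderiv ℝ g (T (ys k), F (ys k))) atTop
        (𝓝 (fderiv ℝ g (T z, F z))) :=
      (hg.continuousAt_fderiv (by simp)).tendsto.comp (hFc.comp hys)
    exact ((continuous_comp_prod T).tendsto (_, J)).comp (h1.prodMk_nhds hJs)
  have hcompact := isCompact_bJacobian hr hF
  apply Subset.antisymm
  · refine convexHull_min ?_ (convex_convexHull _ _)
    borelize V
    -- Points where the composition is differentiable but `F` is not escape the classical chain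
    -- rule; `D` discards them, and it has full measure in the ball by Rademacher.
    refine bJacobian_subset_convexHull (μ := (stdOrthonormalBasis ℝ V).toBasis.addHaar) hr' hlip
      (D := {y | y ∈ ball z r' ∧ DifferentiableAt ℝ F y}) ?_ (hcompact.image
        ((continuous_comp_prod (W := W) T).comp (continuous_const.prodMk continuous_id))) ?_
    · filter_upwards [(hF.mono hsub).ae_differentiableWithinAt_of_mem] with y hy hy'
      exact ⟨hy', (hy hy').differentiableAt (isOpen_ball.mem_nhds hy')⟩
    · intro xs hxs hD
      obtain ⟨J, hJ, κ, hκ, hlim⟩ := exists_subseq_tendsto_bJacobian hr hF hxs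
        fun k => fderiv_mem_bJacobian (hD k).2
      refine ⟨_, mem_image_of_mem _ hJ, κ, hκ, ?_⟩
      refine (hcont _ _ J (hxs.comp hκ.tendsto_atTop) hlim).congr fun k => ?_
      exact (hchain _ (hD (κ k)).1 (hD (κ k)).2).fderiv.symm
  · refine convexHull_mono ?_
    rintro _ ⟨J, ⟨xs, hxs, hd, hJ⟩, rfl⟩
    obtain ⟨k₀, hk₀⟩ := eventually_atTop.1 (hxs (ball_mem_nhds z hr'))
    refine ⟨fun k => xs (k + k₀), hxs.comp (tendsto_add_atTop_nat k₀), fun k => ?_, ?_⟩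
    · exact (hchain _ (hk₀ _ (Nat.le_add_left _ _)) (hd _)).differentiableAt
    · refine ((hcont _ _ J hxs hJ).comp (tendsto_add_atTop_nat k₀)).congr fun k => ?_
      exact (hchain _ (hk₀ _ (Nat.le_add_left _ _)) (hd _)).fderiv.symm

end Composition

/-! ### Graphical derivatives and Fréchet differentiability. -/

section DifferenceQuotients

variable {V W : Type} [NormedAddCommGroup V] [NormedSpace ℝ V] [NormedAddCommGroup W]
  [NormedSpace ℝ W]

/-- The graphical derivative of a function at `w`: all pairs `(e, v)` such that `v` is a limit of
difference quotients of `F` at `w` in directions tending to `e`. -/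
def graphicalDeriv (F : V → W) (w : V) : Set (V × W) :=
  {q | ∃ (t : ℕ → ℝ) (e : ℕ → V), (∀ k, 0 < t k) ∧ Tendsto t atTop (𝓝 0) ∧
    Tendsto e atTop (𝓝 q.1) ∧
    Tendsto (fun k => (t k)⁻¹ • (F (w + t k • e k) - F w)) atTop (𝓝 q.2)}

theorem HasFDerivAt.tendsto_quotient {F : V → W} {J : V →L[ℝ] W} {w : V} (h : HasFDerivAt F J w)
    {t : ℕ → ℝ} (ht : ∀ k, 0 < t k) (ht0 : Tendsto t atTop (𝓝 0)) {e : ℕ → V} {v : V}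
    (he : Tendsto e atTop (𝓝 v)) :
    Tendsto (fun k => (t k)⁻¹ • (F (w + t k • e k) - F w)) atTop (𝓝 (J v)) := by
  refine (hasFDerivWithinAt_univ.2 h).lim ?_ (Eventually.of_forall fun _ => mem_univ _) ?_
  · simpa using ht0.smul he
  · refine he.congr fun k => ?_
    rw [smul_smul, inv_mul_cancel₀ (ht k).ne', one_smul]

theorem mem_graphicalDeriv_iff {F : V → W} {J : V →L[ℝ] W} {w : V} (h : HasFDerivAt F J w)
    (q : V × W) : q ∈ graphicalDeriv F w ↔ q.2 = J q.1 := by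
  constructor
  · rintro ⟨t, e, ht, ht0, he, hv⟩
    exact tendsto_nhds_unique hv (h.tendsto_quotient ht ht0 he)
  · intro hq
    refine ⟨fun k => 1 / ((k : ℝ) + 1), fun _ => q.1, fun k => by positivity,
      tendsto_one_div_add_atTop_nhds_zero_nat, tendsto_const_nhds, ?_⟩
    rw [hq]
    exact h.tendsto_quotient (fun k => by positivity) tendsto_one_div_add_atTop_nhds_zero_nat
      tendsto_const_nhds

theorem eventually_add_smul_mem {w : V} {U : Set V} (hU : U ∈ 𝓝 w) {t : ℕ → ℝ}
    (ht0 : Tendsto t atTop (𝓝 0)) {e : ℕ → V} {v : V} (he : Tendsto e atTop (𝓝 v)) :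
    ∀ᶠ k in atTop, w + t k • e k ∈ U := by
  have : Tendsto (fun k => w + t k • e k) atTop (𝓝 w) := by
    simpa using (ht0.smul he).const_add w
  exact this hU

theorem norm_quotient_le {F : V → W} {w : V} {r : ℝ} (hr : 0 < r) {C : NNReal}
    (hF : LipschitzOnWith C F (ball w r)) {t : ℝ} (ht : 0 < t) {e : V}
    (he : w + t • e ∈ ball w r) : ‖t⁻¹ • (F (w + t • e) - F w)‖ ≤ C * ‖e‖ := by
  have := hF.dist_le_mul _ he _ (mem_ball_self hr)
  rw [dist_eq_norm, dist_eq_norm, add_sub_cancel_left, norm_smul, Real.norm_of_nonneg ht.le] at this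
  rw [norm_smul, norm_inv, Real.norm_of_nonneg ht.le, inv_mul_le_iff₀ ht]
  linarith

theorem norm_le_of_mem_graphicalDeriv {F : V → W} {w : V} {r : ℝ} (hr : 0 < r) {C : NNReal}
    (hF : LipschitzOnWith C F (ball w r)) {q : V × W} (hq : q ∈ graphicalDeriv F w) :
    ‖q.2‖ ≤ C * ‖q.1‖ := by
  obtain ⟨t, e, ht, ht0, he, hv⟩ := hq
  refine le_of_tendsto_of_tendsto hv.norm (he.norm.const_mul _) ?_
  filter_upwards [eventually_add_smul_mem (ball_mem_nhds w hr) ht0 he] with k hk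
  exact norm_quotient_le hr hF (ht k) hk

/-- A Lipschitz function whose graphical derivative is contained in the graph of a linear map is
differentiable. -/
theorem hasFDerivAt_of_graphicalDeriv_subset [FiniteDimensional ℝ V] [FiniteDimensional ℝ W]
    {F : V → W} {w : V} {r : ℝ} (hr : 0 < r) {C : NNReal} (hF : LipschitzOnWith C F (ball w r))
    {J : V →L[ℝ] W} (hJ : ∀ q ∈ graphicalDeriv F w, q.2 = J q.1) : HasFDerivAt F J w := by
  rw [hasFDerivAt_iff_isLittleO_nhds_zero, Asymptotics.isLittleO_iff]
  by_contra! hcon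
  obtain ⟨c, hc, hfreq⟩ := hcon
  obtain ⟨h, hh0, hh⟩ := exists_seq_forall_of_frequently (hfreq.mono fun x hx => hx)
  have hne : ∀ k, h k ≠ 0 := by
    intro k hk
    have := hh k
    simp [hk] at this
  have hpos : ∀ k, 0 < ‖h k‖ := fun k => norm_pos_iff.2 (hne k)
  -- The displacements violating the little-o bound are normalized to unit directions. A cluster
  -- point of the directions and quotients lies in the graphical derivative, yet stays at distance
  -- at least `c` from the graph of `J`.
  set e : ℕ → V := fun k => ‖h k‖⁻¹ • h k
  have hhe : ∀ k, ‖h k‖ • e k = h k := fun k => smul_inv_smul₀ (hpos k).ne' _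
  have hen : ∀ k, ‖e k‖ = 1 := fun k => by
    simp only [e]
    rw [norm_smul, norm_inv, norm_norm, inv_mul_cancel₀ (hpos k).ne']
  have ht0 : Tendsto (fun k => ‖h k‖) atTop (𝓝 0) := by simpa using hh0.norm
  set v : ℕ → W := fun k => ‖h k‖⁻¹ • (F (w + ‖h k‖ • e k) - F w)
  have hnear : ∀ᶠ k in atTop, w + ‖h k‖ • e k ∈ ball w r := by
    have : Tendsto (fun k => w + ‖h k‖ • e k) atTop (𝓝 w) := by
      simpa [hhe] using hh0.const_add w
    exact this (ball_mem_nhds w hr)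
  have hev : ∀ᶠ k in atTop, (e k, v k) ∈ closedBall (0 : V) 1 ×ˢ closedBall (0 : W) C := by
    filter_upwards [hnear] with k hk
    refine ⟨by simp [hen], ?_⟩
    have := norm_quotient_le hr hF (hpos k) hk
    rw [hen, mul_one] at this
    simpa using this
  have : ProperSpace V := FiniteDimensional.proper ℝ V
  have : ProperSpace W := FiniteDimensional.proper ℝ W
  obtain ⟨q, -, κ, hκ, hlim⟩ := tendsto_subseq_of_frequently_bounded
    (isBounded_closedBall.prod isBounded_closedBall) hev.frequently
  rw [nhds_prod_eq, tendsto_prod_iff'] at hlim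
  have hq := hJ q ⟨fun k => ‖h (κ k)‖, fun k => e (κ k), fun k => hpos _,
    ht0.comp hκ.tendsto_atTop, hlim.1, hlim.2⟩
  have hle : c ≤ ‖q.2 - J q.1‖ := by
    refine ge_of_tendsto (hlim.2.sub ((J.continuous.tendsto _).comp hlim.1)).norm
      (Eventually.of_forall fun k => ?_)
    have h1 := hh (κ k)
    have h2 : v (κ k) - J (e (κ k)) = ‖h (κ k)‖⁻¹ • (F (w + h (κ k)) - F w - J (h (κ k))) := by
      simp only [v]
      rw [hhe, smul_sub _ _ (J _)]
      simp [e]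
    simp only [Function.comp_apply]
    rw [h2, norm_smul, norm_inv, norm_norm, le_inv_mul_iff₀ (hpos _)]
    linarith
  rw [hq, sub_self, norm_zero] at hle
  exact absurd hc (not_lt.2 hle)

end DifferenceQuotients

/-! ### Continuity of orthogonal projections onto ranges. -/

section Projections

variable {E V : Type} [NormedAddCommGroup E] [InnerProductSpace ℝ E] [FiniteDimensional ℝ E]
  [NormedAddCommGroup V] [NormedSpace ℝ V]

/-- A vector in the range of `M` is `M v` with `v` recovered by `R`; subtracting `M' v`, which the
complementary projection kills, leaves only `(M - M') v`. -/
theorem norm_compl_starProjection_comp_le {M M' : V →L[ℝ] E} {R : E →L[ℝ] V}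
    (hR : R ∘L M = ContinuousLinearMap.id ℝ V) :
    ‖(ContinuousLinearMap.id ℝ E - M'.range.starProjection) ∘L M.range.starProjection‖ ≤
      ‖M - M'‖ * ‖R‖ := by
  have key : (ContinuousLinearMap.id ℝ E - M'.range.starProjection) ∘L M.range.starProjection =
      M'.rangeᗮ.starProjection ∘L (M - M') ∘L R ∘L M.range.starProjection := by
    ext x
    obtain ⟨v, hv⟩ : M.range.starProjection x ∈ M.range := Submodule.starProjection_apply_mem _ _
    have hv : M v = M.range.starProjection x := hv
    have hRv : R (M v) = v := DFunLike.congr_fun hR v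
    have h0 : M'.rangeᗮ.starProjection (M' v) = 0 := by
      have hmem : M' v ∈ M'.range := LinearMap.mem_range_self (M' : V →ₗ[ℝ] E) v
      rw [Submodule.starProjection_orthogonal_val,
        Submodule.starProjection_eq_self_iff.2 hmem, sub_self]
    simp only [ContinuousLinearMap.comp_apply, ← hv, hRv, _root_.sub_apply, map_sub,
      h0, sub_zero]
    rw [Submodule.starProjection_orthogonal_val]
    rfl
  rw [key]
  refine (ContinuousLinearMap.opNorm_comp_le _ _).trans ?_
  refine (mul_le_of_le_one_left (norm_nonneg _) (Submodule.starProjection_norm_le _)).trans ?_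
  refine (ContinuousLinearMap.opNorm_comp_le _ _).trans ?_
  refine mul_le_mul_of_nonneg_left ?_ (norm_nonneg _)
  refine (ContinuousLinearMap.opNorm_comp_le _ _).trans ?_
  exact mul_le_of_le_one_right (norm_nonneg _) (Submodule.starProjection_norm_le _)

/-- The projections onto the ranges of linear maps with left inverses depend continuously on the
maps. -/
theorem norm_starProjection_range_sub_le {M M' : V →L[ℝ] E} {R R' : E →L[ℝ] V}
    (hR : R ∘L M = ContinuousLinearMap.id ℝ V) (hR' : R' ∘L M' = ContinuousLinearMap.id ℝ V) :
    ‖M.range.starProjection - M'.range.starProjection‖ ≤ ‖M - M'‖ * (‖R‖ + ‖R'‖) := by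
  set P := M.range.starProjection
  set P' := M'.range.starProjection
  have hP : IsSelfAdjoint P := isSelfAdjoint_starProjection _
  have hP' : IsSelfAdjoint P' := isSelfAdjoint_starProjection _
  have h1 : ‖(1 - P') * P‖ ≤ ‖M - M'‖ * ‖R‖ := norm_compl_starProjection_comp_le hR
  have h2 : ‖(1 - P) * P'‖ ≤ ‖M' - M‖ * ‖R'‖ := norm_compl_starProjection_comp_le hR'
  -- Only one-sided estimates are available; self-adjointness turns the second term of `P - P' = (1
  -- - P')P - P'(1 - P)` into the adjoint of one of them.
  have h3 : P' * (1 - P) = star ((1 - P) * P') := by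
    rw [star_mul, star_sub, star_one, hP.star_eq, hP'.star_eq]
  have h4 : P - P' = (1 - P') * P - P' * (1 - P) := by noncomm_ring
  calc ‖P - P'‖ = ‖(1 - P') * P - star ((1 - P) * P')‖ := by rw [h4, h3]
    _ ≤ ‖(1 - P') * P‖ + ‖(1 - P) * P'‖ := by
      rw [← norm_star ((1 - P) * P')]; exact norm_sub_le _ _
    _ ≤ ‖M - M'‖ * (‖R‖ + ‖R'‖) := by
      rw [norm_sub_rev M' M] at h2
      linarith

omit [FiniteDimensional ℝ E] in
theorem finrank_range_of_leftInverse {M : V →L[ℝ] E} {R : E →L[ℝ] V}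
    (hR : R ∘L M = ContinuousLinearMap.id ℝ V) :
    Module.finrank ℝ M.range = Module.finrank ℝ V := by
  refine LinearMap.finrank_range_of_inj (f := (M : V →ₗ[ℝ] E)) ?_
  exact Function.LeftInverse.injective (g := R) fun v => DFunLike.congr_fun hR v

end Projections

/-! ### Tangent cones of a graph parametrized by `(u, x)`. -/

section ImplicitGraph

variable {X Y : Type} [NormedAddCommGroup X] [InnerProductSpace ℝ X]
  [NormedAddCommGroup Y] [InnerProductSpace ℝ Y]

theorem tendsto_toLp_prod {ι : Type*} {l : Filter ι} {a : ι → X} {b : ι → Y} {x : X} {y : Y}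
    (ha : Tendsto a l (𝓝 x)) (hb : Tendsto b l (𝓝 y)) :
    Tendsto (fun k => WithLp.toLp 2 (a k, b k)) l (𝓝 (WithLp.toLp 2 (x, y))) :=
  ((WithLp.prodContinuousLinearEquiv 2 ℝ X Y).symm.continuous.tendsto (x, y)).comp
    (ha.prodMk_nhds hb)

theorem tendsto_withLp_fst {ι : Type*} {l : Filter ι} {a : ι → EProd X Y} {p : EProd X Y}
    (ha : Tendsto a l (𝓝 p)) : Tendsto (fun k => (a k).fst) l (𝓝 p.fst) :=
  ((WithLp.fstL 2 ℝ X Y).continuous.tendsto p).comp ha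

theorem tendsto_withLp_snd {ι : Type*} {l : Filter ι} {a : ι → EProd X Y} {p : EProd X Y}
    (ha : Tendsto a l (𝓝 p)) : Tendsto (fun k => (a k).snd) l (𝓝 p.snd) :=
  ((WithLp.sndL 2 ℝ X Y).continuous.tendsto p).comp ha

/-- The parameter `(u, x)`, `u = f (x, y) + z`, of the point `(x, y, z)`. -/
def paramPoint (f : X × Y → Y) (p : EProd (EProd X Y) Y) : EProd Y X :=
  WithLp.toLp 2 (f (p.fst.fst, p.fst.snd) + p.snd, p.fst.fst)

/-- The point `(x, y, z)`, `y = F (u, x)`, `z = u - f (x, y)`, with parameter `w = (u, x)`. -/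
def solPoint (f : X × Y → Y) (F : EProd Y X → Y) (w : EProd Y X) : EProd (EProd X Y) Y :=
  WithLp.toLp 2 (WithLp.toLp 2 (w.snd, F w), w.fst - f (w.snd, F w))

/-- The linearization of `paramPoint`. -/
noncomputable def paramDeriv (A : X × Y →L[ℝ] Y) : EProd (EProd X Y) Y →L[ℝ] EProd Y X :=
  ((WithLp.prodContinuousLinearEquiv 2 ℝ Y X).symm : Y × X →L[ℝ] EProd Y X) ∘L
    ((A ∘L (WithLp.prodContinuousLinearEquiv 2 ℝ X Y : EProd X Y →L[ℝ] X × Y) ∘L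
      WithLp.fstL 2 ℝ (EProd X Y) Y + WithLp.sndL 2 ℝ (EProd X Y) Y).prod
        (WithLp.fstL 2 ℝ X Y ∘L WithLp.fstL 2 ℝ (EProd X Y) Y))

/-- The linearization of `solPoint`. -/
noncomputable def solDeriv (A : X × Y →L[ℝ] Y) (J : EProd Y X →L[ℝ] Y) :
    EProd Y X →L[ℝ] EProd (EProd X Y) Y :=
  ((WithLp.prodContinuousLinearEquiv 2 ℝ (EProd X Y) Y).symm :
    EProd X Y × Y →L[ℝ] EProd (EProd X Y) Y) ∘L
    ((((WithLp.prodContinuousLinearEquiv 2 ℝ X Y).symm : X × Y →L[ℝ] EProd X Y) ∘L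
      (WithLp.sndL 2 ℝ Y X).prod J).prod
        (WithLp.fstL 2 ℝ Y X - A ∘L (WithLp.sndL 2 ℝ Y X).prod J))

omit [NormedAddCommGroup X] [InnerProductSpace ℝ X] [InnerProductSpace ℝ Y] in
theorem paramPoint_solPoint (f : X × Y → Y) (F : EProd Y X → Y) (w : EProd Y X) :
    paramPoint f (solPoint f F w) = w := by
  change WithLp.toLp 2 (f (w.snd, F w) + (w.fst - f (w.snd, F w)), w.snd) = w
  rw [add_sub_cancel]
  rfl

omit [NormedAddCommGroup X] [InnerProductSpace ℝ X] [InnerProductSpace ℝ Y] in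
theorem solPoint_paramPoint {f : X × Y → Y} {F : EProd Y X → Y} {p : EProd (EProd X Y) Y}
    (hp : p.fst.snd = F (paramPoint f p)) : solPoint f F (paramPoint f p) = p := by
  change WithLp.toLp 2 (WithLp.toLp 2 (p.fst.fst, F (paramPoint f p)),
    f (p.fst.fst, p.fst.snd) + p.snd - f (p.fst.fst, F (paramPoint f p))) = p
  rw [← hp, add_sub_cancel_left]
  rfl

/-- This left inverse does not involve `J`, so it remains controlled when the Jacobians of `F` vary.
-/
theorem paramDeriv_comp_solDeriv (A : X × Y →L[ℝ] Y) (J : EProd Y X →L[ℝ] Y) :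
    paramDeriv A ∘L solDeriv A J = ContinuousLinearMap.id ℝ (EProd Y X) := by
  ext1 e
  change WithLp.toLp 2 (A (e.snd, J e) + (e.fst - A (e.snd, J e)), e.snd) = e
  rw [add_sub_cancel]
  rfl

theorem toLp_paramDeriv (A : X × Y →L[ℝ] Y) (d : EProd (EProd X Y) Y) :
    WithLp.toLp 2 (WithLp.toLp 2 ((paramDeriv A d).snd, d.fst.snd),
      (paramDeriv A d).fst - A ((paramDeriv A d).snd, d.fst.snd)) = d := by
  change WithLp.toLp 2 (WithLp.toLp 2 (d.fst.fst, d.fst.snd),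
    A (d.fst.fst, d.fst.snd) + d.snd - A (d.fst.fst, d.fst.snd)) = d
  rw [add_sub_cancel_left]
  rfl

/-- In the linearized coordinates the range is the graph of `J`, the form in which it is compared
with the contingent cone. -/
theorem mem_range_solDeriv_iff (A : X × Y →L[ℝ] Y) (J : EProd Y X →L[ℝ] Y)
    (d : EProd (EProd X Y) Y) : d ∈ (solDeriv A J).range ↔ d.fst.snd = J (paramDeriv A d) := by
  constructor
  · rintro ⟨e, rfl⟩
    have h : paramDeriv A (solDeriv A J e) = e :=
      DFunLike.congr_fun (paramDeriv_comp_solDeriv A J) e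
    change J e = J (paramDeriv A (solDeriv A J e))
    rw [h]
  · intro h
    refine ⟨paramDeriv A d, ?_⟩
    conv_rhs => rw [← toLp_paramDeriv A d, h]
    rfl

theorem hasFDerivAt_paramPoint {f : X × Y → Y} {A : X × Y →L[ℝ] Y} {p : EProd (EProd X Y) Y}
    (hf : HasFDerivAt f A (p.fst.fst, p.fst.snd)) :
    HasFDerivAt (paramPoint f) (paramDeriv A) p := by
  have h1 : HasFDerivAt (fun p : EProd (EProd X Y) Y => f (p.fst.fst, p.fst.snd))
      (A ∘L ((WithLp.prodContinuousLinearEquiv 2 ℝ X Y : EProd X Y →L[ℝ] X × Y) ∘L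
        WithLp.fstL 2 ℝ (EProd X Y) Y)) p :=
    HasFDerivAt.comp p (g := f) hf
      ((WithLp.prodContinuousLinearEquiv 2 ℝ X Y : EProd X Y →L[ℝ] X × Y) ∘L
        WithLp.fstL 2 ℝ (EProd X Y) Y).hasFDerivAt
  have h2 := (h1.add (WithLp.sndL 2 ℝ (EProd X Y) Y).hasFDerivAt).prodMk
    (WithLp.fstL 2 ℝ X Y ∘L WithLp.fstL 2 ℝ (EProd X Y) Y).hasFDerivAt
  exact ((WithLp.prodContinuousLinearEquiv 2 ℝ Y X).symm :
    Y × X →L[ℝ] EProd Y X).hasFDerivAt.comp p h2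

variable {f : X × Y → Y} {F : EProd Y X → Y} {D : Set (EProd Y X)}
  {G : Set (EProd (EProd X Y) Y)}

/-- The contingent cone of a set parametrized by `solPoint f F`, in terms of the graphical
derivative of `F`. -/
theorem mem_contingentCone_iff_graphicalDeriv (hD : IsOpen D)
    (hG : ∀ p, paramPoint f p ∈ D → (p ∈ G ↔ p.fst.snd = F (paramPoint f p)))
    {p : EProd (EProd X Y) Y} (hpD : paramPoint f p ∈ D) (hpG : p ∈ G) {A : X × Y →L[ℝ] Y}
    (hf : HasFDerivAt f A (p.fst.fst, p.fst.snd)) (d : EProd (EProd X Y) Y) :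
    d ∈ contingentCone G p ↔
      (paramDeriv A d, d.fst.snd) ∈ graphicalDeriv F (paramPoint f p) := by
  have hpF := (hG p hpD).1 hpG
  constructor
  · rintro ⟨t, w, ht, ht0, hw, hmem⟩
    have hquot := (hasFDerivAt_paramPoint hf).tendsto_quotient ht ht0 hw
    -- Difference quotients of `paramPoint` serve as directions, so the displaced parameter is
    -- exactly that of the displaced graph point.
    have heq : ∀ k, paramPoint f p + t k • ((t k)⁻¹ • (paramPoint f (p + t k • w k) -
        paramPoint f p)) = paramPoint f (p + t k • w k) := fun k => by
      rw [smul_inv_smul₀ (ht k).ne', add_sub_cancel]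
    refine ⟨t, _, ht, ht0, hquot, ?_⟩
    have hev := eventually_add_smul_mem
      ((hasFDerivAt_paramPoint hf).continuousAt.preimage_mem_nhds (hD.mem_nhds hpD)) ht0 hw
    refine (tendsto_withLp_snd (tendsto_withLp_fst hw)).congr' ?_
    filter_upwards [hev] with k hk
    rw [heq, ← (hG _ hk).1 (hmem k), ← hpF]
    change _ = (t k)⁻¹ • (p.fst.snd + t k • (w k).fst.snd - p.fst.snd)
    rw [add_sub_cancel_left, inv_smul_smul₀ (ht k).ne']
  · rintro ⟨t, e, ht, ht0, he, hv⟩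
    set w := paramPoint f p
    set v : ℕ → Y := fun k => (t k)⁻¹ • (F (w + t k • e k) - F w)
    -- The quotient of `f` along the lifted curve corrects the `z`-component so that the lifted
    -- points lie exactly on the parametrized graph.
    set q : ℕ → Y := fun k => (t k)⁻¹ • (f ((w.snd, F w) + t k • ((e k).snd, v k)) - f (w.snd, F w))
    have hpw : solPoint f F w = p := solPoint_paramPoint hpF
    have hf' : HasFDerivAt f A (w.snd, F w) := by
      have : (w.snd, F w) = (p.fst.fst, p.fst.snd) := by rw [hpF]; rfl
      rwa [this]
    have hq : Tendsto q atTop (𝓝 (A ((paramDeriv A d).snd, d.fst.snd))) :=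
      hf'.tendsto_quotient ht ht0 ((tendsto_withLp_snd he).prodMk_nhds hv)
    have hpoint : ∀ k, p + t k • WithLp.toLp 2 (WithLp.toLp 2 ((e k).snd, v k), (e k).fst - q k) =
        solPoint f F (w + t k • e k) := by
      intro k
      have h1 : F w + t k • v k = F (w + t k • e k) := by
        simp only [v]
        rw [smul_inv_smul₀ (ht k).ne', add_sub_cancel]
      have h2 : f (w.snd, F w) + t k • q k = f (w.snd + t k • (e k).snd, F w + t k • v k) := by
        simp only [q]
        rw [smul_inv_smul₀ (ht k).ne', add_sub_cancel]
        rfl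
      rw [← hpw]
      change WithLp.toLp 2 (WithLp.toLp 2 (w.snd + t k • (e k).snd, F w + t k • v k),
        w.fst - f (w.snd, F w) + t k • ((e k).fst - q k)) = WithLp.toLp 2 (WithLp.toLp 2
          (w.snd + t k • (e k).snd, F (w + t k • e k)), w.fst + t k • (e k).fst -
            f (w.snd + t k • (e k).snd, F (w + t k • e k)))
      rw [← h1, ← h2, smul_sub]
      congr 2
      abel
    have hlim : Tendsto (fun k => WithLp.toLp 2 (WithLp.toLp 2 ((e k).snd, v k), (e k).fst - q k))
        atTop (𝓝 d) := by
      have := tendsto_toLp_prod (tendsto_toLp_prod (tendsto_withLp_snd he) hv)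
        ((tendsto_withLp_fst he).sub hq)
      simp only at this
      rwa [toLp_paramDeriv] at this
    -- The contingent cone asks for membership at every index, so the initial terms that may leave
    -- `D` are dropped.
    obtain ⟨k₀, hk₀⟩ := eventually_atTop.1 (eventually_add_smul_mem (hD.mem_nhds hpD) ht0 he)
    refine ⟨fun k => t (k + k₀), _, fun k => ht _, ht0.comp (tendsto_add_atTop_nat k₀),
      hlim.comp (tendsto_add_atTop_nat k₀), fun k => ?_⟩
    simp only [Function.comp_apply]
    rw [hpoint, hG _ (by rw [paramPoint_solPoint]; exact hk₀ _ (Nat.le_add_left _ _)),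
      paramPoint_solPoint]
    rfl

theorem contingentCone_eq_range_solDeriv (hD : IsOpen D)
    (hG : ∀ p, paramPoint f p ∈ D → (p ∈ G ↔ p.fst.snd = F (paramPoint f p)))
    {p : EProd (EProd X Y) Y} (hpD : paramPoint f p ∈ D) (hpG : p ∈ G) {A : X × Y →L[ℝ] Y}
    (hf : HasFDerivAt f A (p.fst.fst, p.fst.snd)) (hF : DifferentiableAt ℝ F (paramPoint f p)) :
    contingentCone G p = (solDeriv A (fderiv ℝ F (paramPoint f p))).range := by
  ext d
  rw [mem_contingentCone_iff_graphicalDeriv hD hG hpD hpG hf, mem_graphicalDeriv_iff hF.hasFDerivAt]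
  exact (mem_range_solDeriv_iff A _ d).symm

/-- If the contingent cone is a subspace of the right dimension, then `F` is differentiable. -/
theorem differentiableAt_of_contingentCone_eq [FiniteDimensional ℝ X] [FiniteDimensional ℝ Y]
    (hD : IsOpen D) (hG : ∀ p, paramPoint f p ∈ D → (p ∈ G ↔ p.fst.snd = F (paramPoint f p)))
    {p : EProd (EProd X Y) Y} (hpD : paramPoint f p ∈ D) (hpG : p ∈ G) {A : X × Y →L[ℝ] Y}
    (hf : HasFDerivAt f A (p.fst.fst, p.fst.snd)) {r : ℝ} (hr : 0 < r) {C : NNReal}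
    (hF : LipschitzOnWith C F (ball (paramPoint f p) r))
    {L : Submodule ℝ (EProd (EProd X Y) Y)} (hL : (L : Set (EProd (EProd X Y) Y)) =
      contingentCone G p) (hdim : Module.finrank ℝ L = Module.finrank ℝ (EProd Y X)) :
    DifferentiableAt ℝ F (paramPoint f p) := by
  have hmem : ∀ d, d ∈ L ↔ (paramDeriv A d, d.fst.snd) ∈ graphicalDeriv F (paramPoint f p) := by
    intro d
    rw [← mem_contingentCone_iff_graphicalDeriv hD hG hpD hpG hf, ← hL]
    rfl
  set R : L →ₗ[ℝ] EProd Y X := (paramDeriv A : EProd (EProd X Y) Y →ₗ[ℝ] EProd Y X).domRestrict L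
  -- A tangent vector with zero parameter part has zero `y`-part by the Lipschitz estimate, hence
  -- vanishes. Equality of dimensions then makes `R` an isomorphism.
  have hRinj : Function.Injective R := by
    rw [injective_iff_map_eq_zero]
    rintro ⟨d, hd⟩ hRd
    have hRd : paramDeriv A d = 0 := hRd
    have h1 := norm_le_of_mem_graphicalDeriv hr hF ((hmem d).1 hd)
    simp only [hRd, norm_zero, mul_zero, norm_le_zero_iff] at h1
    have h2 := toLp_paramDeriv A d
    rw [hRd, h1] at h2
    refine Subtype.ext ?_
    change d = 0
    rw [← h2]
    change WithLp.toLp 2 (WithLp.toLp 2 ((0 : X), (0 : Y)), (0 : Y) - A (0 : X × Y)) = 0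
    rw [map_zero, sub_zero]
    rfl
  set e := LinearMap.linearEquivOfInjective R hRinj hdim
  -- The candidate derivative lifts a parameter direction to its unique tangent vector in `L` and
  -- reads off the `y`-component.
  set J : EProd Y X →L[ℝ] Y := LinearMap.toContinuousLinearMap
    (((WithLp.sndL 2 ℝ X Y ∘L WithLp.fstL 2 ℝ (EProd X Y) Y :
      EProd (EProd X Y) Y →L[ℝ] Y) : EProd (EProd X Y) Y →ₗ[ℝ] Y) ∘ₗ L.subtype ∘ₗ
      (e.symm : EProd Y X →ₗ[ℝ] L))
  refine (hasFDerivAt_of_graphicalDeriv_subset hr hF (J := J) ?_).differentiableAt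
  rintro ⟨a, v⟩ hav
  set d : EProd (EProd X Y) Y := WithLp.toLp 2 (WithLp.toLp 2 (a.snd, v), a.fst - A (a.snd, v))
  have hda : paramDeriv A d = a := by
    change WithLp.toLp 2 (A (a.snd, v) + (a.fst - A (a.snd, v)), a.snd) = a
    rw [add_sub_cancel]
    rfl
  have hdL : d ∈ L := by
    rw [hmem, hda]
    exact hav
  have hea : e.symm a = ⟨d, hdL⟩ := by
    rw [LinearEquiv.symm_apply_eq]
    exact hda.symm
  change v = (e.symm a : EProd (EProd X Y) Y).fst.snd
  rw [hea]
  rfl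

end ImplicitGraph

/-! ### SC derivative versus B-Jacobian. -/

section SCDerivative

variable {X Y : Type} [NormedAddCommGroup X] [InnerProductSpace ℝ X]
  [NormedAddCommGroup Y] [InnerProductSpace ℝ Y]

theorem continuous_solDeriv : Continuous fun q : (X × Y →L[ℝ] Y) × (EProd Y X →L[ℝ] Y) =>
    solDeriv q.1 q.2 := by
  have h1 : Continuous fun q : (X × Y →L[ℝ] Y) × (EProd Y X →L[ℝ] Y) =>
      (WithLp.sndL 2 ℝ Y X).prod q.2 :=
    continuous_clm_prod.comp (continuous_const.prodMk continuous_snd)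
  exact continuous_const.clm_comp (continuous_clm_prod.comp ((continuous_const.clm_comp h1).prodMk
    (continuous_const.sub (continuous_fst.clm_comp h1))))

theorem continuous_paramDeriv : Continuous fun A : X × Y →L[ℝ] Y => paramDeriv A :=
  continuous_const.clm_comp (continuous_clm_prod.comp
    (((continuous_id.clm_comp continuous_const).add continuous_const).prodMk continuous_const))

theorem finrank_eProd_comm [FiniteDimensional ℝ X] [FiniteDimensional ℝ Y] :
    Module.finrank ℝ (EProd Y X) = Module.finrank ℝ (EProd X Y) := by
  rw [(WithLp.linearEquiv 2 ℝ (Y × X)).finrank_eq, (WithLp.linearEquiv 2 ℝ (X × Y)).finrank_eq,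
    Module.finrank_prod, Module.finrank_prod, add_comm]

omit [NormedAddCommGroup X] [InnerProductSpace ℝ X] [InnerProductSpace ℝ Y] in
theorem solPoint_mem {f : X × Y → Y} {F : EProd Y X → Y} {D : Set (EProd Y X)}
    {G : Set (EProd (EProd X Y) Y)}
    (hG : ∀ p, paramPoint f p ∈ D → (p ∈ G ↔ p.fst.snd = F (paramPoint f p)))
    {w : EProd Y X} (hw : w ∈ D) : solPoint f F w ∈ G := by
  rw [hG _ (by rwa [paramPoint_solPoint]), paramPoint_solPoint]
  rfl

theorem contingentCone_solPoint {f : X × Y → Y} {F : EProd Y X → Y} {D : Set (EProd Y X)}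
    (hD : IsOpen D) {G : Set (EProd (EProd X Y) Y)}
    (hG : ∀ p, paramPoint f p ∈ D → (p ∈ G ↔ p.fst.snd = F (paramPoint f p)))
    {w : EProd Y X} (hw : w ∈ D) {A : X × Y →L[ℝ] Y} (hf : HasFDerivAt f A (w.snd, F w))
    (hF : DifferentiableAt ℝ F w) :
    contingentCone G (solPoint f F w) = (solDeriv A (fderiv ℝ F w)).range := by
  have hpar := paramPoint_solPoint f F w
  have := contingentCone_eq_range_solDeriv hD hG (p := solPoint f F w) (by rwa [hpar])
    (solPoint_mem hG hw) hf (by rwa [hpar])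
  rwa [hpar] at this

variable [FiniteDimensional ℝ X] [FiniteDimensional ℝ Y]

theorem finrank_range_solDeriv (A : X × Y →L[ℝ] Y) (J : EProd Y X →L[ℝ] Y) :
    Module.finrank ℝ (solDeriv A J).range = Module.finrank ℝ (EProd X Y) := by
  rw [finrank_range_of_leftInverse (paramDeriv_comp_solDeriv A J), finrank_eProd_comm]

-- Each `M k e` is fixed by its projection; in the limit `N e` is fixed by the projection onto `L`.
omit [FiniteDimensional ℝ X] [FiniteDimensional ℝ Y] in
theorem range_le_of_tendsto_starProjection {E V : Type} [NormedAddCommGroup E]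
    [InnerProductSpace ℝ E] [FiniteDimensional ℝ E] [NormedAddCommGroup V] [NormedSpace ℝ V]
    {M : ℕ → V →L[ℝ] E} {N : V →L[ℝ] E} (hM : Tendsto M atTop (𝓝 N)) {L : Submodule ℝ E}
    {Ls : ℕ → Submodule ℝ E} (hLs : ∀ k, Ls k = (M k).range)
    (hL : Tendsto (fun k => ‖L.starProjection - (Ls k).starProjection‖) atTop (𝓝 0)) :
    N.range ≤ L := by
  obtain rfl : Ls = fun k => (M k).range := funext hLs
  have hP : Tendsto (fun k => (M k).range.starProjection) atTop (𝓝 L.starProjection) := by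
    rw [tendsto_iff_norm_sub_tendsto_zero]
    exact hL.congr fun k => norm_sub_rev _ _
  rintro _ ⟨e, rfl⟩
  have happly : Continuous fun q : (V →L[ℝ] E) × V => q.1 q.2 := by fun_prop
  have happly' : Continuous fun q : (E →L[ℝ] E) × E => q.1 q.2 := by fun_prop
  have h1 : Tendsto (fun k => M k e) atTop (𝓝 (N e)) :=
    (happly.tendsto (N, e)).comp (hM.prodMk_nhds tendsto_const_nhds)
  have h2 : Tendsto (fun k => (M k).range.starProjection (M k e)) atTop
      (𝓝 (L.starProjection (N e))) :=
    (happly'.tendsto (L.starProjection, N e)).comp (hP.prodMk_nhds h1)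
  have h3 : ∀ k, (M k).range.starProjection (M k e) = M k e := fun k =>
    Submodule.starProjection_eq_self_iff.2 (LinearMap.mem_range_self (M k : V →ₗ[ℝ] E) e)
  simp only [h3] at h2
  exact Submodule.starProjection_eq_self_iff.1 (tendsto_nhds_unique h2 h1)

/-- Subspace tangent cones force differentiability of `F` at the parameters, and a subsequence of
the derivatives converges to the required `J`. -/
theorem exists_mem_bJacobian_of_mem_scDeriv {f : X × Y → Y} (hf : ContDiff ℝ 1 f)
    {F : EProd Y X → Y} {D : Set (EProd Y X)} (hD : IsOpen D) {Q : EProd X Y → Set Y}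
    (hG : ∀ p, paramPoint f p ∈ D → (p ∈ graphOf Q ↔ p.fst.snd = F (paramPoint f p)))
    {w : EProd Y X} (hw : w ∈ D) {r : ℝ} (hr : 0 < r) {C : NNReal}
    (hF : LipschitzOnWith C F (ball w r)) {L : Submodule ℝ (EProd (EProd X Y) Y)}
    (hL : L ∈ scDeriv Q (solPoint f F w)) :
    ∃ J ∈ bJacobian F w, L = (solDeriv (fderiv ℝ f (w.snd, F w)) J).range := by
  have hfd : ∀ q, HasFDerivAt f (fderiv ℝ f q) q := fun q =>
    (hf.differentiable (by simp) q).hasFDerivAt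
  have hfc : Continuous (fderiv ℝ f) := hf.continuous_fderiv (by simp)
  obtain ⟨hLdim, ps, Ls, hps, hLs, hlim⟩ := hL
  have hpar : Tendsto (fun k => paramPoint f (ps k)) atTop (𝓝 w) := by
    have := (hasFDerivAt_paramPoint (hfd ((solPoint f F w).fst.fst,
      (solPoint f F w).fst.snd))).continuousAt.tendsto.comp hps
    rwa [paramPoint_solPoint] at this
  obtain ⟨k₀, hk₀⟩ := eventually_atTop.1
    (hpar (inter_mem (hD.mem_nhds hw) (ball_mem_nhds w hr)))
  have hdiff : ∀ k ≥ k₀, DifferentiableAt ℝ F (paramPoint f (ps k)) := by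
    intro k hk
    obtain ⟨hkD, hkb⟩ := hk₀ k hk
    obtain ⟨r', hr', hsub⟩ := Metric.isOpen_iff.1 isOpen_ball _ hkb
    exact differentiableAt_of_contingentCone_eq hD hG hkD (hLs k).1 (hfd _) hr' (hF.mono hsub)
      (hLs k).2.1 ((hLs k).2.2.trans finrank_eProd_comm.symm)
  have hLM : ∀ k ≥ k₀, Ls k = (solDeriv (fderiv ℝ f ((ps k).fst.fst, (ps k).fst.snd))
      (fderiv ℝ F (paramPoint f (ps k)))).range := fun k hk =>
    SetLike.coe_injective ((hLs k).2.1.trans (contingentCone_eq_range_solDeriv hD hG (hk₀ k hk).1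
      (hLs k).1 (hfd _) (hdiff k hk)))
  obtain ⟨J, hJ, κ, hκ, hκJ⟩ := exists_subseq_tendsto_bJacobian hr hF
    (hpar.comp (tendsto_add_atTop_nat k₀))
    fun k => fderiv_mem_bJacobian (hdiff (k + k₀) (Nat.le_add_left _ _))
  refine ⟨J, hJ, ?_⟩
  have hκ' : Tendsto (fun k => κ k + k₀) atTop atTop :=
    (tendsto_add_atTop_nat k₀).comp hκ.tendsto_atTop
  have hps' := hps.comp hκ'
  have hA : Tendsto (fun k => fderiv ℝ f ((ps (κ k + k₀)).fst.fst, (ps (κ k + k₀)).fst.snd))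
      atTop (𝓝 (fderiv ℝ f (w.snd, F w))) :=
    (hfc.tendsto _).comp ((tendsto_withLp_fst (tendsto_withLp_fst hps')).prodMk_nhds
      (tendsto_withLp_snd (tendsto_withLp_fst hps')))
  have hM := (continuous_solDeriv.tendsto (fderiv ℝ f (w.snd, F w), J)).comp (hA.prodMk_nhds hκJ)
  -- One inclusion between the limit range and `L` suffices, since both have the same dimension.
  refine (Submodule.eq_of_le_of_finrank_eq (range_le_of_tendsto_starProjection hM
    (fun k => hLM (κ k + k₀) (Nat.le_add_left _ _)) (hlim.comp hκ'))
    ((finrank_range_solDeriv _ _).trans hLdim.symm)).symm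

omit [FiniteDimensional ℝ X] [FiniteDimensional ℝ Y] in
theorem exists_seq_mem_of_mem_bJacobian {F : X → Y} {x : X} {U : Set X} (hU : U ∈ 𝓝 x)
    {J : X →L[ℝ] Y} (hJ : J ∈ bJacobian F x) :
    ∃ xs : ℕ → X, Tendsto xs atTop (𝓝 x) ∧ (∀ k, xs k ∈ U) ∧
      (∀ k, DifferentiableAt ℝ F (xs k)) ∧ Tendsto (fun k => fderiv ℝ F (xs k)) atTop (𝓝 J) := by
  obtain ⟨xs, hxs, hd, hJ⟩ := hJ
  obtain ⟨k₀, hk₀⟩ := eventually_atTop.1 (hxs hU)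
  exact ⟨fun k => xs (k + k₀), hxs.comp (tendsto_add_atTop_nat k₀),
    fun k => hk₀ _ (Nat.le_add_left _ _), fun k => hd _, hJ.comp (tendsto_add_atTop_nat k₀)⟩

omit [FiniteDimensional ℝ X] [FiniteDimensional ℝ Y] in
theorem tendsto_starProjection_range {E V : Type} [NormedAddCommGroup E]
    [InnerProductSpace ℝ E] [FiniteDimensional ℝ E] [NormedAddCommGroup V] [NormedSpace ℝ V]
    {Ms : ℕ → V →L[ℝ] E} {M : V →L[ℝ] E} {Rs : ℕ → E →L[ℝ] V} {R : E →L[ℝ] V}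
    (hM : Tendsto Ms atTop (𝓝 M)) (hR : Tendsto Rs atTop (𝓝 R))
    (hRM : R ∘L M = ContinuousLinearMap.id ℝ V)
    (hRMs : ∀ k, Rs k ∘L Ms k = ContinuousLinearMap.id ℝ V) :
    Tendsto (fun k => ‖M.range.starProjection - (Ms k).range.starProjection‖) atTop (𝓝 0) := by
  have h1 : Tendsto (fun k => ‖M - Ms k‖) atTop (𝓝 0) := by
    simpa using (hM.const_sub M).norm
  have h2 := h1.mul (hR.norm.const_add ‖R‖)
  rw [zero_mul] at h2
  exact squeeze_zero (fun _ => norm_nonneg _) (fun k => norm_starProjection_range_sub_le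
    hRM (hRMs k)) h2

/-- At points of differentiability the tangent cones are ranges of `solDeriv`. Their left inverses
`paramDeriv` converge too, which yields convergence of the projections. -/
theorem range_solDeriv_mem_scDeriv {f : X × Y → Y} (hf : ContDiff ℝ 1 f) {F : EProd Y X → Y}
    {D : Set (EProd Y X)} (hD : IsOpen D) {Q : EProd X Y → Set Y}
    (hG : ∀ p, paramPoint f p ∈ D → (p ∈ graphOf Q ↔ p.fst.snd = F (paramPoint f p)))
    {w : EProd Y X} (hw : w ∈ D) {r : ℝ} (hr : 0 < r) {C : NNReal}
    (hF : LipschitzOnWith C F (ball w r)) {J : EProd Y X →L[ℝ] Y}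
    (hJ : J ∈ bJacobian F w) :
    (solDeriv (fderiv ℝ f (w.snd, F w)) J).range ∈ scDeriv Q (solPoint f F w) := by
  have hfd : ∀ q, HasFDerivAt f (fderiv ℝ f q) q := fun q =>
    (hf.differentiable (by simp) q).hasFDerivAt
  have hfc : Continuous (fderiv ℝ f) := hf.continuous_fderiv (by simp)
  obtain ⟨ws, hws, hwD, hd, hJ⟩ := exists_seq_mem_of_mem_bJacobian (hD.mem_nhds hw) hJ
  have hFw : Tendsto (fun k => F (ws k)) atTop (𝓝 (F w)) :=
    (hF.continuousOn.continuousAt (ball_mem_nhds w hr)).tendsto.comp hws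
  have hxy : Tendsto (fun k => ((ws k).snd, F (ws k))) atTop (𝓝 (w.snd, F w)) :=
    (tendsto_withLp_snd hws).prodMk_nhds hFw
  have hA : Tendsto (fun k => fderiv ℝ f ((ws k).snd, F (ws k))) atTop
      (𝓝 (fderiv ℝ f (w.snd, F w))) := (hfc.tendsto (w.snd, F w)).comp hxy
  have hfw : Tendsto (fun k => f ((ws k).snd, F (ws k))) atTop (𝓝 (f (w.snd, F w))) :=
    (hf.continuous.tendsto (w.snd, F w)).comp hxy
  have hps : Tendsto (fun k => solPoint f F (ws k)) atTop (𝓝 (solPoint f F w)) :=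
    tendsto_toLp_prod (tendsto_toLp_prod (tendsto_withLp_snd hws) hFw)
      ((tendsto_withLp_fst hws).sub hfw)
  have hM := (continuous_solDeriv.tendsto (fderiv ℝ f (w.snd, F w), J)).comp (hA.prodMk_nhds hJ)
  have hR := (continuous_paramDeriv.tendsto (fderiv ℝ f (w.snd, F w))).comp hA
  simp only [Function.comp_def] at hM hR
  have hlim := tendsto_starProjection_range hM hR (paramDeriv_comp_solDeriv _ _)
    fun k => paramDeriv_comp_solDeriv _ _
  exact ⟨finrank_range_solDeriv _ _, fun k => solPoint f F (ws k),
    fun k => (solDeriv (fderiv ℝ f ((ws k).snd, F (ws k))) (fderiv ℝ F (ws k))).range, hps,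
    fun k => ⟨solPoint_mem hG (hwD k),
      (contingentCone_solPoint hD hG (hwD k) (hfd _) (hd k)).symm, finrank_range_solDeriv _ _⟩,
    hlim⟩

/-- The SC derivative of a mapping whose graph is locally parametrized by the graph of a Lipschitz
function `F`, in terms of the B-Jacobian of `F`. -/
theorem mem_scDeriv_iff {f : X × Y → Y} (hf : ContDiff ℝ 1 f) {F : EProd Y X → Y}
    {D : Set (EProd Y X)} (hD : IsOpen D) {Q : EProd X Y → Set Y}
    (hG : ∀ p, paramPoint f p ∈ D → (p ∈ graphOf Q ↔ p.fst.snd = F (paramPoint f p)))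
    {w : EProd Y X} (hw : w ∈ D) {r : ℝ} (hr : 0 < r) {C : NNReal}
    (hF : LipschitzOnWith C F (ball w r)) (L : Submodule ℝ (EProd (EProd X Y) Y)) :
    L ∈ scDeriv Q (solPoint f F w) ↔
      ∃ J ∈ bJacobian F w, L = (solDeriv (fderiv ℝ f (w.snd, F w)) J).range := by
  refine ⟨exists_mem_bJacobian_of_mem_scDeriv hf hD hG hw hr hF, ?_⟩
  rintro ⟨J, hJ, rfl⟩
  exact range_solDeriv_mem_scDeriv hf hD hG hw hr hF hJ

end SCDerivative

/-! ### Adjoint subspaces and independence of the basis. -/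

section Adjoint

/-- The inclusion `y ↦ (y, 0)` into the Euclidean product. -/
noncomputable def eInl (Y X : Type) [NormedAddCommGroup X] [InnerProductSpace ℝ X]
    [NormedAddCommGroup Y] [InnerProductSpace ℝ Y] : Y →L[ℝ] EProd Y X :=
  ((WithLp.prodContinuousLinearEquiv 2 ℝ Y X).symm : Y × X →L[ℝ] EProd Y X) ∘L
    ContinuousLinearMap.inl ℝ Y X

/-- The inclusion `x ↦ (0, x)` into the Euclidean product. -/
noncomputable def eInr (Y X : Type) [NormedAddCommGroup X] [InnerProductSpace ℝ X]
    [NormedAddCommGroup Y] [InnerProductSpace ℝ Y] : X →L[ℝ] EProd Y X :=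
  ((WithLp.prodContinuousLinearEquiv 2 ℝ Y X).symm : Y × X →L[ℝ] EProd Y X) ∘L
    ContinuousLinearMap.inr ℝ Y X

theorem eInl_apply {X Y : Type} [NormedAddCommGroup X] [InnerProductSpace ℝ X]
    [NormedAddCommGroup Y] [InnerProductSpace ℝ Y] (y : Y) :
    eInl Y X y = WithLp.toLp 2 (y, 0) := rfl

theorem eInr_apply {X Y : Type} [NormedAddCommGroup X] [InnerProductSpace ℝ X]
    [NormedAddCommGroup Y] [InnerProductSpace ℝ Y] (x : X) :
    eInr Y X x = WithLp.toLp 2 (0, x) := rfl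

variable {X Y : Type} [NormedAddCommGroup X] [InnerProductSpace ℝ X]
  [NormedAddCommGroup Y] [InnerProductSpace ℝ Y]

theorem mem_adjointSubspace_iff_inner (A : X × Y →L[ℝ] Y) (J : EProd Y X →L[ℝ] Y)
    (q : EProd Y (EProd X Y)) : q ∈ adjointSubspace (solDeriv A J).range ↔ ∀ (u : Y) (x : X),
      inner ℝ x q.snd.fst + inner ℝ (J (WithLp.toLp 2 (u, x))) q.snd.snd -
        inner ℝ (u - A (x, J (WithLp.toLp 2 (u, x)))) q.fst = 0 := by
  have key : ∀ (p : EProd X Y) (v : Y), WithLp.toLp 2 (p, v) ∈ (solDeriv A J).rangeᗮ ↔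
      ∀ (u : Y) (x : X), inner ℝ x p.fst + inner ℝ (J (WithLp.toLp 2 (u, x))) p.snd +
        inner ℝ (u - A (x, J (WithLp.toLp 2 (u, x)))) v = 0 := by
    intro p v
    rw [Submodule.mem_orthogonal]
    constructor
    · intro h u x
      have := h _ (LinearMap.mem_range_self
        (solDeriv A J : EProd Y X →ₗ[ℝ] EProd (EProd X Y) Y) (WithLp.toLp 2 (u, x)))
      rw [WithLp.prod_inner_apply, WithLp.prod_inner_apply] at this
      exact this
    · rintro h _ ⟨e, rfl⟩
      rw [WithLp.prod_inner_apply, WithLp.prod_inner_apply]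
      exact h e.fst e.snd
  constructor
  · rintro ⟨p, v, hpv, rfl⟩ u x
    have := (key p v).1 hpv u x
    change inner ℝ x p.fst + inner ℝ (J (WithLp.toLp 2 (u, x))) p.snd -
        inner ℝ (u - A (x, J (WithLp.toLp 2 (u, x)))) (-v) = 0
    rwa [inner_neg_right, sub_neg_eq_add]
  · intro h
    refine ⟨q.snd, -q.fst, (key _ _).2 fun u x => ?_, ?_⟩
    · rw [inner_neg_right, ← sub_eq_add_neg]
      exact h u x
    · rw [neg_neg]
      rfl

open ContinuousLinearMap in
/-- The adjoint of the subspace `range (solDeriv A J)`, in terms of the blocks of `A` and `J`. -/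
theorem mem_adjointSubspace_iff [CompleteSpace X] [CompleteSpace Y] (A : X × Y →L[ℝ] Y)
    (J : EProd Y X →L[ℝ] Y) (q : EProd Y (EProd X Y)) :
    q ∈ adjointSubspace (solDeriv A J).range ↔
      q.fst = adjoint (J ∘L eInl Y X) (q.snd.snd + adjoint (A ∘L inr ℝ X Y) q.fst) ∧
      q.snd.fst = -adjoint (A ∘L inl ℝ X Y) q.fst -
        adjoint (J ∘L eInr Y X) (q.snd.snd + adjoint (A ∘L inr ℝ X Y) q.fst) := by
  set r := q.snd.snd + adjoint (A ∘L inr ℝ X Y) q.fst with hr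
  have hJ : ∀ u x, J (WithLp.toLp 2 (u, x)) = (J ∘L eInl Y X) u + (J ∘L eInr Y X) x := by
    intro u x
    rw [comp_apply, comp_apply, ← map_add, eInl_apply, eInr_apply, ← WithLp.toLp_add]
    simp
  have hA : ∀ x y, A (x, y) = (A ∘L inl ℝ X Y) x + (A ∘L inr ℝ X Y) y := by
    intro x y
    rw [comp_apply, comp_apply, ← map_add]
    simp
  -- Moving all operators to the other side separates the orthogonality condition into independent
  -- pairings with `u` and `x`, each of which must vanish.
  have hform : ∀ u x, inner ℝ x q.snd.fst + inner ℝ (J (WithLp.toLp 2 (u, x))) q.snd.snd -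
      inner ℝ (u - A (x, J (WithLp.toLp 2 (u, x)))) q.fst =
      inner ℝ u (adjoint (J ∘L eInl Y X) r - q.fst) + inner ℝ x (q.snd.fst -
        (-adjoint (A ∘L inl ℝ X Y) q.fst - adjoint (J ∘L eInr Y X) r)) := by
    intro u x
    rw [hA, hJ]
    set a := J ∘L eInl Y X
    set b := J ∘L eInr Y X
    set c := A ∘L inl ℝ X Y
    set d := A ∘L inr ℝ X Y
    simp only [hr, inner_add_left, inner_sub_left, inner_add_right, inner_sub_right,
      inner_neg_right, adjoint_inner_right, map_add]
    ring
  rw [mem_adjointSubspace_iff_inner]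
  simp only [hform]
  constructor
  · intro h
    constructor
    · have := h (adjoint (J ∘L eInl Y X) r - q.fst) 0
      rw [inner_zero_left, add_zero, inner_self_eq_zero] at this
      exact (sub_eq_zero.1 this).symm
    · have := h 0 (q.snd.fst - (-adjoint (A ∘L inl ℝ X Y) q.fst - adjoint (J ∘L eInr Y X) r))
      rw [inner_zero_left, zero_add, inner_self_eq_zero] at this
      exact sub_eq_zero.1 this
  · rintro ⟨h1, h2⟩ u x
    rw [← h1, ← h2, sub_self, sub_self, inner_zero_right, inner_zero_right, add_zero]

open ContinuousLinearMap in
theorem exists_rangeOfBasis_eq {n m : ℕ} (A : Eu n × Eu m →L[ℝ] Eu m)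
    (J : EProd (Eu m) (Eu n) →L[ℝ] Eu m) :
    ∃ Z X Y, rangeOfBasis Z X Y = adjointSubspace (solDeriv A J).range := by
  set a := adjoint (J ∘L eInl (Eu m) (Eu n))
  set b := adjoint (J ∘L eInr (Eu m) (Eu n))
  set c := adjoint (A ∘L inl ℝ (Eu n) (Eu m))
  set d := adjoint (A ∘L inr ℝ (Eu n) (Eu m))
  -- The adjoint subspace is parametrized by `p = y* + d z*`: its equations give `z* = a p`, `x* =
  -- -c z* - b p` and `y* = p - d z*`.
  refine ⟨a, -(c ∘L a) - b, ContinuousLinearMap.id ℝ _ - d ∘L a, ?_⟩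
  ext q
  rw [mem_adjointSubspace_iff]
  constructor
  · rintro ⟨p, rfl⟩
    change a p = a ((p - d (a p)) + d (a p)) ∧
      -(c (a p)) - b p = -c (a p) - b ((p - d (a p)) + d (a p))
    rw [sub_add_cancel]
    exact ⟨rfl, rfl⟩
  · rintro ⟨h1, h2⟩
    refine ⟨q.snd.snd + d q.fst, ?_⟩
    change WithLp.toLp 2 (a (q.snd.snd + d q.fst), WithLp.toLp 2
      (-(c (a (q.snd.snd + d q.fst))) - b (q.snd.snd + d q.fst),
        (q.snd.snd + d q.fst) - d (a (q.snd.snd + d q.fst)))) = q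
    rw [← h1, ← h2, add_sub_cancel_right]
    rfl

-- With `B = d Z + Y`, the subspace equations give `X = -c Z - b B`, so `Zᵀ A_x + Xᵀ = -Bᵀ J_x`. The
-- factor `Bᵀ` cancels and the choice of basis disappears.
open ContinuousLinearMap in
theorem eq_of_rangeOfBasis_eq {n m : ℕ} {A : Eu n × Eu m →L[ℝ] Eu m}
    {J : EProd (Eu m) (Eu n) →L[ℝ] Eu m} {Z : Eu m →L[ℝ] Eu m} {X : Eu m →L[ℝ] Eu n}
    {Y : Eu m →L[ℝ] Eu m} (h : rangeOfBasis Z X Y = adjointSubspace (solDeriv A J).range) :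
    -((adjoint ((adjoint (A ∘L inr ℝ (Eu n) (Eu m)) ∘L Z + Y).inverse)) ∘L
      (adjoint Z ∘L (A ∘L inl ℝ (Eu n) (Eu m)) + adjoint X)) = J ∘L eInr (Eu m) (Eu n) := by
  have hmem := mem_adjointSubspace_iff A J
  rw [← h] at hmem
  set a := adjoint (J ∘L eInl (Eu m) (Eu n)) with ha
  set b := adjoint (J ∘L eInr (Eu m) (Eu n)) with hb
  set c := adjoint (A ∘L inl ℝ (Eu n) (Eu m)) with hc
  set d := adjoint (A ∘L inr ℝ (Eu n) (Eu m)) with hd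
  set B := d ∘L Z + Y with hB
  have hX : X = -(c ∘L Z) - b ∘L B := by
    ext1 p
    have := ((hmem _).1 ⟨p, rfl⟩).2
    change X p = -c (Z p) - b (Y p + d (Z p)) at this
    rw [this, add_comm (Y p)]
    rfl
  -- Every `r` is the value of `y* + d z*` at some element of the adjoint subspace, and that element
  -- is in the range of the given basis.
  have hsurj : Function.Surjective B := by
    intro r
    obtain ⟨p, hp⟩ := (hmem (WithLp.toLp 2 (a r, WithLp.toLp 2
      (-(c (a r)) - b r, r - d (a r))))).2 (by
        change a r = a ((r - d (a r)) + d (a r)) ∧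
          -(c (a r)) - b r = -c (a r) - b ((r - d (a r)) + d (a r))
        rw [sub_add_cancel]
        exact ⟨rfl, rfl⟩)
    have h1 : Z p = a r := congrArg (fun q => q.fst) hp
    have h2 : Y p = r - d (a r) := congrArg (fun q => q.snd.snd) hp
    refine ⟨p, ?_⟩
    change d (Z p) + Y p = r
    rw [h1, h2, add_sub_cancel]
  have hinj : Function.Injective B := LinearMap.injective_iff_surjective.2 hsurj
  set e := (LinearEquiv.ofBijective (B : Eu m →ₗ[ℝ] Eu m) ⟨hinj, hsurj⟩).toContinuousLinearEquiv
  have heB : (e : Eu m →L[ℝ] Eu m) = B := rfl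
  have hadj : adjoint Z ∘L (A ∘L inl ℝ (Eu n) (Eu m)) + adjoint X =
      -(adjoint B ∘L (J ∘L eInr (Eu m) (Eu n))) := by
    rw [hX, map_sub, map_neg, adjoint_comp, adjoint_comp, hc, hb, adjoint_adjoint, adjoint_adjoint]
    abel
  have hinv : adjoint B.inverse ∘L adjoint B = ContinuousLinearMap.id ℝ (Eu m) := by
    rw [← adjoint_comp, ← heB, inverse_equiv, ContinuousLinearEquiv.coe_comp_coe_symm, adjoint_id]
  rw [hadj, comp_neg, neg_neg, ← comp_assoc, hinv, id_comp]

end Adjoint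

/-! ### Normal cones to `{0} × U`. -/

section NormalCones

variable {X Y : Type} [NormedAddCommGroup X] [InnerProductSpace ℝ X]
  [NormedAddCommGroup Y] [InnerProductSpace ℝ Y]

theorem mem_contingentCone_zero_prod {U : Set X} {p : EProd Y X} (hp : p.fst = 0)
    (d : EProd Y X) : d ∈ contingentCone {p : EProd Y X | p.fst = 0 ∧ p.snd ∈ U} p ↔
      d.fst = 0 ∧ d.snd ∈ contingentCone U p.snd := by
  constructor
  · rintro ⟨t, w, ht, ht0, hw, hmem⟩
    refine ⟨?_, t, fun k => (w k).snd, ht, ht0, tendsto_withLp_snd hw, fun k => (hmem k).2⟩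
    refine tendsto_nhds_unique (tendsto_withLp_fst hw) (tendsto_const_nhds.congr fun k => ?_)
    have h1 : p.fst + t k • (w k).fst = 0 := (hmem k).1
    rw [hp, zero_add] at h1
    exact ((smul_eq_zero.1 h1).resolve_left (ht k).ne').symm
  · rintro ⟨hd, t, w, ht, ht0, hw, hmem⟩
    refine ⟨t, fun k => WithLp.toLp 2 (0, w k), ht, ht0, ?_, fun k => ⟨?_, hmem k⟩⟩
    · have hdd : WithLp.toLp 2 (0, d.snd) = d := by rw [← hd]; rfl
      have := tendsto_toLp_prod (tendsto_const_nhds (x := (0 : Y))) hw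
      rwa [hdd] at this
    · change p.fst + t k • (0 : Y) = 0
      rw [hp, smul_zero, add_zero]

theorem mem_regularNormalCone_zero_prod {U : Set X} {p : EProd Y X} (hp : p.fst = 0)
    (v : EProd Y X) : v ∈ regularNormalCone {p : EProd Y X | p.fst = 0 ∧ p.snd ∈ U} p ↔
      v.snd ∈ regularNormalCone U p.snd := by
  constructor
  · intro h w hw
    have := h (WithLp.toLp 2 (0, w)) ((mem_contingentCone_zero_prod hp _).2 ⟨rfl, hw⟩)
    rw [WithLp.prod_inner_apply] at this
    change inner ℝ v.fst (0 : Y) + inner ℝ v.snd w ≤ 0 at this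
    rwa [inner_zero_right, zero_add] at this
  · intro h w hw
    obtain ⟨hw0, hw1⟩ := (mem_contingentCone_zero_prod hp _).1 hw
    rw [WithLp.prod_inner_apply]
    change inner ℝ v.fst w.fst + inner ℝ v.snd w.snd ≤ 0
    rw [hw0, inner_zero_right, zero_add]
    exact h _ hw1

/-- The limiting normal cone to `{0} × U` is `Y × N_U`. -/
theorem mem_limitingNormalCone_zero_prod {U : Set X} {x : X} (v : EProd Y X) :
    v ∈ limitingNormalCone {p : EProd Y X | p.fst = 0 ∧ p.snd ∈ U} (WithLp.toLp 2 (0, x)) ↔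
      v.snd ∈ limitingNormalCone U x := by
  constructor
  · rintro ⟨as, vs, has, hlim, hvs, hv⟩
    exact ⟨fun k => (as k).snd, fun k => (vs k).snd, fun k => (has k).2, tendsto_withLp_snd hlim,
      fun k => (mem_regularNormalCone_zero_prod (has k).1 _).1 (hvs k), tendsto_withLp_snd hv⟩
  · rintro ⟨as, vs, has, hlim, hvs, hv⟩
    -- The first block of a normal vector is unrestricted, so it can be kept constant along the
    -- sequence.
    exact ⟨fun k => WithLp.toLp 2 (0, as k), fun k => WithLp.toLp 2 (v.fst, vs k),
      fun k => ⟨rfl, has k⟩, tendsto_toLp_prod tendsto_const_nhds hlim,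
      fun k => (mem_regularNormalCone_zero_prod rfl _).2 (hvs k),
      tendsto_toLp_prod tendsto_const_nhds hv⟩

/-- Stationarity with respect to `{0} × U` only involves the second block of the gradients. -/
theorem zero_mem_colVectors_add_iff [CompleteSpace X] [CompleteSpace Y]
    (C : Set (EProd Y X →L[ℝ] ℝ)) (U : Set X) (x : X) :
    (0 : X) ∈ colVectors ((fun G : EProd Y X →L[ℝ] ℝ => G ∘L eInr Y X) '' C) +
        limitingNormalCone U x ↔
      (0 : EProd Y X) ∈ colVectors C +
        limitingNormalCone {p : EProd Y X | p.fst = 0 ∧ p.snd ∈ U} (WithLp.toLp 2 (0, x)) := by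
  have hblock : ∀ p : EProd Y X, innerSL ℝ p ∘L eInr Y X = innerSL ℝ p.snd := by
    intro p
    ext1 d
    change inner ℝ p (WithLp.toLp 2 ((0 : Y), d)) = inner ℝ p.snd d
    rw [WithLp.prod_inner_apply]
    change inner ℝ p.fst (0 : Y) + inner ℝ p.snd d = inner ℝ p.snd d
    rw [inner_zero_right, zero_add]
  constructor
  · rintro ⟨a, ⟨G, hG, hGa⟩, b, hb, hab⟩
    have hab : a + b = 0 := hab
    set p : EProd Y X := (InnerProductSpace.toDual ℝ (EProd Y X)).symm G
    have hp : innerSL ℝ p = G := (InnerProductSpace.toDual ℝ (EProd Y X)).apply_symm_apply G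
    have hpa : p.snd = a := by
      have h1 : innerSL ℝ p ∘L eInr Y X = innerSL ℝ a := by rw [hp]; exact hGa
      rw [hblock] at h1
      exact (InnerProductSpace.toDual ℝ X).injective h1
    -- The free first block of the normal vector is chosen to cancel the `u`-gradient.
    refine ⟨p, ?_, WithLp.toLp 2 (-p.fst, b), (mem_limitingNormalCone_zero_prod _).2 hb, ?_⟩
    · change innerSL ℝ p ∈ C
      rwa [hp]
    · change WithLp.toLp 2 (p.fst + -p.fst, p.snd + b) = (0 : EProd Y X)
      rw [hpa, hab, add_neg_cancel]
      rfl
  · rintro ⟨p, hp, q, hq, hpq⟩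
    refine ⟨p.snd, ⟨innerSL ℝ p, hp, hblock p⟩, q.snd, (mem_limitingNormalCone_zero_prod _).1 hq,
      ?_⟩
    exact congrArg (fun r : EProd Y X => r.snd) hpq

end NormalCones

/-! ### Identification of `Ψ` and `Θ`, and the equivalence. -/

section ImplicitMappings

variable {n m : ℕ} {f : Eu n → Eu m → Eu m} {Q : Eu n → Eu m → Set (Eu m)} {Ω : Set (Eu n)}
  {δ : ℝ} {S : Eu m → Eu n → Eu m}

theorem isOpen_eProd_prod {B : Set (Eu m)} (hB : IsOpen B) (hΩ : IsOpen Ω) :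
    IsOpen {w : EProd (Eu m) (Eu n) | w.fst ∈ B ∧ w.snd ∈ Ω} :=
  (hB.preimage (WithLp.fstL 2 ℝ (Eu m) (Eu n)).continuous).inter
    (hΩ.preimage (WithLp.sndL 2 ℝ (Eu m) (Eu n)).continuous)

theorem exists_lipschitzOnWith_ball (hΩ : IsOpen Ω)
    (hLip : LocallyLipschitzOn (ball (0 : Eu m) δ ×ˢ Ω) (fun p : Eu m × Eu n => S p.1 p.2))
    {w : EProd (Eu m) (Eu n)} (hw : w.fst ∈ ball (0 : Eu m) δ ∧ w.snd ∈ Ω) :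
    ∃ r > 0, ∃ C, LipschitzOnWith C (fun w : EProd (Eu m) (Eu n) => S w.fst w.snd) (ball w r) := by
  set e := WithLp.prodContinuousLinearEquiv 2 ℝ (Eu m) (Eu n)
  obtain ⟨K, t, ht, hK⟩ := hLip (x := (w.fst, w.snd)) hw
  have ht' : t ∈ 𝓝 (e w) := by
    have := (isOpen_ball.prod hΩ).mem_nhds (show (w.fst, w.snd) ∈ ball (0 : Eu m) δ ×ˢ Ω from hw)
    rwa [nhdsWithin_eq_nhds.2 this] at ht
  obtain ⟨r, hr, hsub⟩ := Metric.mem_nhds_iff.1 (e.continuous.continuousAt.preimage_mem_nhds ht')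
  exact ⟨r, hr, _, hK.comp e.lipschitz.lipschitzOnWith hsub⟩

/-- Given `x` and `y`, the equation `u = f(x, y) + z` determines `z` from `u`, so single-valuedness
of `S̃` is precisely the parametrization hypothesis on `gph Q`. -/
theorem mem_graphOf_iff_of_perturbedSolutions
    (hS : ∀ u ∈ ball (0 : Eu m) δ, ∀ x ∈ Ω, perturbedSolutions f Q u x = {S u x})
    (p : EProd (EProd (Eu n) (Eu m)) (Eu m))
    (hp : paramPoint (fun q : Eu n × Eu m => f q.1 q.2) p ∈
      {w : EProd (Eu m) (Eu n) | w.fst ∈ ball (0 : Eu m) δ ∧ w.snd ∈ Ω}) :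
    p ∈ graphOf (uncurryMap Q) ↔ p.fst.snd = (fun w : EProd (Eu m) (Eu n) => S w.fst w.snd)
      (paramPoint (fun q : Eu n × Eu m => f q.1 q.2) p) := by
  have h := hS _ hp.1 _ hp.2
  have h1 : p ∈ graphOf (uncurryMap Q) ↔ p.fst.snd ∈ perturbedSolutions f Q
      (f p.fst.fst p.fst.snd + p.snd) p.fst.fst := by
    constructor
    · intro hz
      exact ⟨p.snd, hz, rfl⟩
    · rintro ⟨z, hz, heq⟩
      rw [add_right_inj] at heq
      change p.snd ∈ Q p.fst.fst p.fst.snd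
      rwa [heq]
  rw [h1]
  change p.fst.snd ∈ perturbedSolutions f Q
    (paramPoint (fun q : Eu n × Eu m => f q.1 q.2) p).fst
    (paramPoint (fun q : Eu n × Eu m => f q.1 q.2) p).snd ↔ _
  rw [h]
  rfl

/-- The mapping `Ψ` consists of the `x`-blocks of the B-Jacobian of the perturbed solution
mapping. -/
theorem implicitPsi_eq (hf : ContDiff ℝ 1 (fun p : Eu n × Eu m => f p.1 p.2)) (hΩ : IsOpen Ω)
    (hδ : 0 < δ) (hS : ∀ u ∈ ball (0 : Eu m) δ, ∀ x ∈ Ω, perturbedSolutions f Q u x = {S u x})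
    (hLip : LocallyLipschitzOn (ball (0 : Eu m) δ ×ˢ Ω) (fun p : Eu m × Eu n => S p.1 p.2))
    {x : Eu n} (hx : x ∈ Ω) :
    implicitPsi f Q Ω (fun x => S 0 x) x =
      (fun J : EProd (Eu m) (Eu n) →L[ℝ] Eu m => J ∘L eInr (Eu m) (Eu n)) ''
        bJacobian (fun w : EProd (Eu m) (Eu n) => S w.fst w.snd) (WithLp.toLp 2 (0, x)) := by
  set F : EProd (Eu m) (Eu n) → Eu m := fun w => S w.fst w.snd
  set g : Eu n × Eu m → Eu m := fun p => f p.1 p.2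
  set w : EProd (Eu m) (Eu n) := WithLp.toLp 2 (0, x)
  have hw : w ∈ {w : EProd (Eu m) (Eu n) | w.fst ∈ ball (0 : Eu m) δ ∧ w.snd ∈ Ω} :=
    ⟨mem_ball_self hδ, hx⟩
  obtain ⟨r, hr, C, hF⟩ := exists_lipschitzOnWith_ball hΩ hLip hw
  have hsc := mem_scDeriv_iff hf (isOpen_eProd_prod isOpen_ball hΩ)
    (mem_graphOf_iff_of_perturbedSolutions hS) hw hr hF
  have hpt : solPoint g F w = WithLp.toLp 2 (WithLp.toLp 2 (x, S 0 x), -f x (S 0 x)) := by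
    change WithLp.toLp 2 (WithLp.toLp 2 (x, S 0 x), 0 - f x (S 0 x)) = _
    rw [zero_sub]
  have hfd : HasFDerivAt g (fderiv ℝ g (x, S 0 x)) (x, S 0 x) :=
    (hf.differentiable (by simp) _).hasFDerivAt
  have hfy : fderiv ℝ (fun y => f x y) (S 0 x) =
      fderiv ℝ g (x, S 0 x) ∘L ContinuousLinearMap.inr ℝ (Eu n) (Eu m) :=
    (HasFDerivAt.comp (S 0 x) hfd (hasFDerivAt_prodMk_right x (S 0 x))).fderiv
  have hfx : fderiv ℝ (fun x' => f x' (S 0 x)) x =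
      fderiv ℝ g (x, S 0 x) ∘L ContinuousLinearMap.inl ℝ (Eu n) (Eu m) :=
    (HasFDerivAt.comp (f := fun e => (e, S 0 x)) x hfd (hasFDerivAt_prodMk_left x (S 0 x))).fderiv
  rw [hpt] at hsc
  ext A
  constructor
  · rintro ⟨-, Z, X, Y, ⟨L, hL, hLeq⟩, rfl⟩
    obtain ⟨J, hJ, rfl⟩ := (hsc L).1 hL
    refine ⟨J, hJ, ?_⟩
    simp only
    rw [hfy, hfx]
    exact (eq_of_rangeOfBasis_eq hLeq.symm).symm
  · rintro ⟨J, hJ, rfl⟩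
    obtain ⟨Z, X, Y, h⟩ := exists_rangeOfBasis_eq (fderiv ℝ g (x, S 0 x)) J
    refine ⟨hx, Z, X, Y, ⟨_, (hsc _).2 ⟨J, hJ, rfl⟩, h.symm⟩, ?_⟩
    simp only
    rw [hfy, hfx]
    exact (eq_of_rangeOfBasis_eq h).symm

theorem contDiffAt_of_contDiffOn_prod_univ {φ : Eu n → Eu m → ℝ} (hΩ : IsOpen Ω)
    (hφ : ContDiffOn ℝ 1 (fun p : Eu n × Eu m => φ p.1 p.2) (Ω ×ˢ univ)) {x : Eu n} (hx : x ∈ Ω)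
    (y : Eu m) : ContDiffAt ℝ 1 (fun p : Eu n × Eu m => φ p.1 p.2) (x, y) :=
  hφ.contDiffAt ((hΩ.prod isOpen_univ).mem_nhds ⟨hx, mem_univ y⟩)

/-- Splitting the gradient of `φ` into blocks writes `Θ` as the image of the B-Jacobian under one
affine map, suited to the chain rule and to limits. -/
theorem implicitTheta_eq (hf : ContDiff ℝ 1 (fun p : Eu n × Eu m => f p.1 p.2)) (hΩ : IsOpen Ω)
    (hδ : 0 < δ) (hS : ∀ u ∈ ball (0 : Eu m) δ, ∀ x ∈ Ω, perturbedSolutions f Q u x = {S u x})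
    (hLip : LocallyLipschitzOn (ball (0 : Eu m) δ ×ˢ Ω) (fun p : Eu m × Eu n => S p.1 p.2))
    {φ : Eu n → Eu m → ℝ}
    (hφ : ContDiffOn ℝ 1 (fun p : Eu n × Eu m => φ p.1 p.2) (Ω ×ˢ univ)) {x : Eu n} (hx : x ∈ Ω) :
    implicitTheta f Q (gradientMap φ) Ω (fun x => S 0 x) x =
      (fun J : EProd (Eu m) (Eu n) →L[ℝ] Eu m =>
        fderiv ℝ (fun p : Eu n × Eu m => φ p.1 p.2) (x, S 0 x) ∘L
          (ContinuousLinearMap.id ℝ (Eu n)).prod (J ∘L eInr (Eu m) (Eu n))) ''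
        bJacobian (fun w : EProd (Eu m) (Eu n) => S w.fst w.snd) (WithLp.toLp 2 (0, x)) := by
  have hd := ((contDiffAt_of_contDiffOn_prod_univ hΩ hφ hx (S 0 x)).differentiableAt
    (by simp)).hasFDerivAt
  have hy := (HasFDerivAt.comp (S 0 x) hd (hasFDerivAt_prodMk_right x (S 0 x))).fderiv
  have hx' := (HasFDerivAt.comp (f := fun e => (e, S 0 x)) x hd
    (hasFDerivAt_prodMk_left x (S 0 x))).fderiv
  have hsplit : ∀ A : Eu n →L[ℝ] Eu m, fderiv ℝ (fun x' => φ x' (S 0 x)) x +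
      fderiv ℝ (fun y' => φ x y') (S 0 x) ∘L A =
        fderiv ℝ (fun p : Eu n × Eu m => φ p.1 p.2) (x, S 0 x) ∘L
          (ContinuousLinearMap.id ℝ (Eu n)).prod A := by
    intro A
    have h1 : fderiv ℝ (fun x' => φ x' (S 0 x)) x = _ := hx'
    have h2 : fderiv ℝ (fun y' => φ x y') (S 0 x) = _ := hy
    rw [h1, h2]
    ext1 v
    simp only [_root_.add_apply, ContinuousLinearMap.comp_apply, ← map_add]
    simp
  ext ξ
  constructor
  · rintro ⟨-, -, rfl, A, hA, rfl⟩
    rw [implicitPsi_eq hf hΩ hδ hS hLip hx] at hA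
    obtain ⟨J, hJ, rfl⟩ := hA
    exact ⟨J, hJ, (hsplit _).symm⟩
  · rintro ⟨J, hJ, rfl⟩
    refine ⟨hx, _, rfl, J ∘L eInr (Eu m) (Eu n), ?_, (hsplit _).symm⟩
    rw [implicitPsi_eq hf hΩ hδ hS hLip hx]
    exact ⟨J, hJ, rfl⟩

/-- The mapping `Θ` has closed graph at the points of `Ω`. -/
theorem clMap_implicitTheta (hf : ContDiff ℝ 1 (fun p : Eu n × Eu m => f p.1 p.2)) (hΩ : IsOpen Ω)
    (hδ : 0 < δ) (hS : ∀ u ∈ ball (0 : Eu m) δ, ∀ x ∈ Ω, perturbedSolutions f Q u x = {S u x})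
    (hLip : LocallyLipschitzOn (ball (0 : Eu m) δ ×ˢ Ω) (fun p : Eu m × Eu n => S p.1 p.2))
    {φ : Eu n → Eu m → ℝ}
    (hφ : ContDiffOn ℝ 1 (fun p : Eu n × Eu m => φ p.1 p.2) (Ω ×ˢ univ)) {x : Eu n} (hx : x ∈ Ω) :
    clMap (implicitTheta f Q (gradientMap φ) Ω (fun x => S 0 x)) x =
      implicitTheta f Q (gradientMap φ) Ω (fun x => S 0 x) x := by
  refine Subset.antisymm (fun ξ hξ => ?_) fun ξ hξ => subset_closure hξ
  obtain ⟨q, hq, hlim⟩ := mem_closure_iff_seq_limit.1 hξ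
  rw [nhds_prod_eq, tendsto_prod_iff'] at hlim
  obtain ⟨hlim₁, hlim₂⟩ := hlim
  have hΘ : ∀ k, ∃ J ∈ bJacobian (fun w : EProd (Eu m) (Eu n) => S w.fst w.snd)
      (WithLp.toLp 2 (0, (q k).1)),
      fderiv ℝ (fun p : Eu n × Eu m => φ p.1 p.2) ((q k).1, S 0 (q k).1) ∘L
          (ContinuousLinearMap.id ℝ (Eu n)).prod (J ∘L eInr (Eu m) (Eu n)) = (q k).2 := by
    intro k
    have hk : (q k).2 ∈ implicitTheta f Q (gradientMap φ) Ω (fun x => S 0 x) (q k).1 := hq k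
    rw [implicitTheta_eq hf hΩ hδ hS hLip hφ hk.1] at hk
    exact hk
  choose Js hJs hJq using hΘ
  have hw : Tendsto (fun k => WithLp.toLp 2 ((0 : Eu m), (q k).1)) atTop
      (𝓝 (WithLp.toLp 2 (0, x))) := tendsto_toLp_prod tendsto_const_nhds hlim₁
  obtain ⟨r, hr, C, hF⟩ := exists_lipschitzOnWith_ball hΩ hLip
    (w := WithLp.toLp 2 ((0 : Eu m), x)) ⟨mem_ball_self hδ, hx⟩
  -- The Jacobians behind the elements of `Θ` have a convergent subsequence; continuity of `S̃` and
  -- `∇φ` identifies the limit functional.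
  obtain ⟨J, hJ, κ, hκ, hκJ⟩ := exists_subseq_tendsto_bJacobian hr hF hw hJs
  rw [implicitTheta_eq hf hΩ hδ hS hLip hφ hx]
  refine ⟨J, hJ, tendsto_nhds_unique ?_ (hlim₂.comp hκ.tendsto_atTop)⟩
  have hSx : Tendsto (fun k => S 0 (q k).1) atTop (𝓝 (S 0 x)) :=
    (hF.continuousOn.continuousAt (ball_mem_nhds _ hr)).tendsto.comp hw
  have hD := ((contDiffAt_of_contDiffOn_prod_univ hΩ hφ hx (S 0 x)).continuousAt_fderiv
    (by simp)).tendsto.comp ((hlim₁.prodMk_nhds hSx).comp hκ.tendsto_atTop)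
  have hpre : Continuous fun J : EProd (Eu m) (Eu n) →L[ℝ] Eu m => J ∘L eInr (Eu m) (Eu n) :=
    continuous_id.clm_comp continuous_const
  have := ((continuous_comp_prod (W := Eu m) (ContinuousLinearMap.id ℝ (Eu n))).tendsto (_, _)).comp
    (hD.prodMk_nhds ((hpre.tendsto J).comp hκJ))
  refine this.congr fun k => ?_
  exact hJq (κ k)

theorem image_comp_convexHull {V Z : Type} [NormedAddCommGroup V] [NormedSpace ℝ V]
    [NormedAddCommGroup Z] [NormedSpace ℝ Z] (T : Z →L[ℝ] V) (s : Set (V →L[ℝ] ℝ)) :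
    (fun G : V →L[ℝ] ℝ => G ∘L T) '' convexHull ℝ s =
      convexHull ℝ ((fun G : V →L[ℝ] ℝ => G ∘L T) '' s) :=
  IsLinearMap.image_convexHull (𝕜 := ℝ) (f := fun G : V →L[ℝ] ℝ => G ∘L T)
    ⟨fun G G' => ContinuousLinearMap.add_comp G G' T,
      fun c G => ContinuousLinearMap.smul_comp c G T⟩ s

/-- The chain rule is applied to the full B-Jacobian in `(u, x)` with `T` the projection to `x`.
Restriction to `x`-directions is linear, so it commutes with the convex hull. -/
theorem convexHull_implicitTheta (hf : ContDiff ℝ 1 (fun p : Eu n × Eu m => f p.1 p.2))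
    (hΩ : IsOpen Ω) (hδ : 0 < δ)
    (hS : ∀ u ∈ ball (0 : Eu m) δ, ∀ x ∈ Ω, perturbedSolutions f Q u x = {S u x})
    (hLip : LocallyLipschitzOn (ball (0 : Eu m) δ ×ˢ Ω) (fun p : Eu m × Eu n => S p.1 p.2))
    {φ : Eu n → Eu m → ℝ}
    (hφ : ContDiffOn ℝ 1 (fun p : Eu n × Eu m => φ p.1 p.2) (Ω ×ˢ univ)) {x : Eu n} (hx : x ∈ Ω) :
    convexHull ℝ (implicitTheta f Q (gradientMap φ) Ω (fun x => S 0 x) x) =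
      (fun G : EProd (Eu m) (Eu n) →L[ℝ] ℝ => G ∘L eInr (Eu m) (Eu n)) ''
        convexHull ℝ (bJacobian (fun p : EProd (Eu m) (Eu n) => φ p.snd (S p.fst p.snd))
          (WithLp.toLp 2 (0, x))) := by
  obtain ⟨r, hr, C, hF⟩ := exists_lipschitzOnWith_ball hΩ hLip
    (w := WithLp.toLp 2 ((0 : Eu m), x)) ⟨mem_ball_self hδ, hx⟩
  have hφx := contDiffAt_of_contDiffOn_prod_univ hΩ hφ hx (S 0 x)
  have hchain := convexHull_bJacobian_comp_prod hr hF (T := WithLp.sndL 2 ℝ (Eu m) (Eu n))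
    (g := fun p : Eu n × Eu m => φ p.1 p.2) hφx
  change _ = _ '' convexHull ℝ (bJacobian (fun p : EProd (Eu m) (Eu n) =>
    (fun p : Eu n × Eu m => φ p.1 p.2) (WithLp.sndL 2 ℝ (Eu m) (Eu n) p, S p.fst p.snd)) _)
  rw [hchain, image_comp_convexHull, image_image,
    implicitTheta_eq hf hΩ hδ hS hLip hφ hx]
  rfl

end ImplicitMappings

theorem mainTheorem1 {n m : ℕ}
    (f : Eu n → Eu m → Eu m) (hf : ContDiff ℝ 1 (fun p : Eu n × Eu m => f p.1 p.2))
    (Q : Eu n → Eu m → Set (Eu m)) (hQ : IsClosed (graphOf (uncurryMap Q)))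
    (Ω Uad : Set (Eu n)) (hΩ : IsOpen Ω) (hUad : IsConvexPolyhedron Uad) (hsub : Uad ⊆ Ω)
    (δ : ℝ) (hδ : 0 < δ) (S : Eu m → Eu n → Eu m)
    (hS : ∀ u ∈ ball (0 : Eu m) δ, ∀ x ∈ Ω, perturbedSolutions f Q u x = {S u x})
    (hLip : LocallyLipschitzOn (ball (0 : Eu m) δ ×ˢ Ω) (fun p : Eu m × Eu n => S p.1 p.2))
    (φ : Eu n → Eu m → ℝ)
    (hφ : ContDiffOn ℝ 1 (fun p : Eu n × Eu m => φ p.1 p.2) (Ω ×ˢ univ))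
    (xhat : Eu n) (hx : xhat ∈ Uad) :
    IsPseudoStationary (implicitTheta f Q (gradientMap φ) Ω (fun x => S 0 x)) Uad xhat ↔
      IsClarkeStationary (fun p : EProd (Eu m) (Eu n) => φ p.snd (S p.fst p.snd))
        {p : EProd (Eu m) (Eu n) | p.fst = 0 ∧ p.snd ∈ Uad} (WithLp.toLp 2 (0, xhat)) := by
  unfold IsPseudoStationary IsClarkeStationary coclMap clarkeSubdiff
  rw [clMap_implicitTheta hf hΩ hδ hS hLip hφ (hsub hx),
    convexHull_implicitTheta hf hΩ hδ hS hLip hφ (hsub hx)]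
  exact zero_mem_colVectors_add_iff _ _ _
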